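/- Let $e_1,e_2,e_3$ be the standard basis of $\mathbb R^3$ and let $\Upsilon=\{s e_i : i\in\{1,2,3\},\ 0\le s\le 1\}\subset\mathbb R^3$ be the Y-graph. A point $x\in\Upsilon$ is written $x=|x|\,e_{\iota(x)}$, where the index $\iota(x)$ is undefined for $x=0$; indices are added modulo $3$. Let $\Delta\subset\Upsilon\times\Upsilon$ be the diagonal and let $\mathcal C=(\Upsilon\times\Upsilon)\setminus\Delta$ be the configuration space of two distinct points on $\Upsilon$. Let $\mathcal D=\{(x,y)\in\mathcal C:\iota(x)\ne\iota(y)\}$ (an undefined index counts as different from a defined one) and $\partial\mathcal D=\{(x,y)\in\mathcal D : |x|=1 \text{ or } |y|=1\}$. **Theorem.** There exists a piecewise-smooth vector field $X$ on $\mathcal C$ (at each point tangent to $\mathcal C$, and, on each of finitely many convex cells with polytopal closure that together make up $\mathcal C$, the restriction of a $C^\infty$ map) with the properties 1–3 below. Explicitly, they hold for the field $X(x,y)=(\dot x,\dot y)$ given by * if $\iota(x)=\iota(y)$: $\ (-|y|e_{\iota(x)},\ |y|(1-|y|)e_{\iota(y)})$ for $0<|x|<|y|$, and $(|x|(1-|x|)e_{\iota(x)},\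 -|x|e_{\iota(y)})$ for $0<|y|<|x|$; * if $\iota(x)=\iota(y)+1$ or $x=0$: $\ (|y|e_{\iota(y)+1},\ |y|(1-|y|)e_{\iota(y)})$ for $0\le|x|<|y|$, and $(|x|(1-|x|)e_{\iota(x)},\ -|x|e_{\iota(y)})$ for $0<|y|\le|x|$; * if $\iota(y)=\iota(x)+1$ or $y=0$: $\ (-|y|e_{\iota(x)},\ |y|(1-|y|)e_{\iota(y)})$ for $0<|x|\le|y|$, and $(|x|(1-|x|)e_{\iota(x)},\ |x|e_{\iota(x)+1})$ for $0\le|y|<|x|$. 1. $X$ vanishes nowhere and generates a continuous semiflow $\varphi:[0,\infty)\times\mathcal C\to\mathcal C$: for every $p$, the curve $t\mapsto\varphi_t(p)$ has right derivative $X(\varphi_t(p))$ at every $t\ge0$, and every continuous curve $\gamma:[0,T)\to\mathcal C$ with right derivative $X(\gamma(t))$ at every $t$ satisfies $\gamma(t)=\varphi_t(\gamma(0))$. 2. The diagonal $\Delta$ is repelling: it has a neighbourhood $U$ such that for every neighbourhood $V$ of $\Delta$ there is a time $T$ with $\varphi_t(p)\notin U$ for all $p\in\mathcal C\setminus V$ and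 all $t\ge T$. 3. The set $\Gamma=\partial\mathcal D$ is an attracting limit cycle (a nonconstant periodic orbit that is the limit of an orbit starting off $\Gamma$, is Lyapunov stable, and is approached by all orbits starting near it) and is the only periodic orbit of $\varphi$. Every orbit approaches $\Gamma$: it is eventually in each neighbourhood of $\Gamma$, and its $\omega$-limit set is $\Gamma$. The cycle runs through all ordered pairs of distinct edge-states: for all $p\in\Gamma$ and $i\neq j$ there is $t\ge0$ such that, at $\varphi_t(p)=(x,y)$, $\iota(x)=i$ and $\iota(y)=j$. -/

import Mathlib

open Set Filter Topology
open scoped NNReal ContDiff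

noncomputable section

namespace YGraph

/-- Pairs of vectors of `ℝ³`. Only the topology and the linear structure matter; the norm used on
`ℝ³` is the maximum norm, and `‖s • e i‖ = s` for `0 ≤ s`, as for the Euclidean norm. -/
abbrev Pairs : Type := (Fin 3 → ℝ) × (Fin 3 → ℝ)

/-- The `i`-th unit vector of `ℝ³`; it is also the outward unit tangent vector of the edge `i`. -/
def e (i : Fin 3) : Fin 3 → ℝ := Pi.single i 1

/-- The Y-graph, as the positive unit axis frame in `ℝ³`; the central vertex is `0`. -/
def graph : Set (Fin 3 → ℝ) := {x | ∃ i : Fin 3, ∃ s ∈ Icc (0 : ℝ) 1, x = s • e i}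

/-- The diagonal of the product of the Y-graph with itself. -/
def diagonal : Set Pairs := {p | p.1 ∈ graph ∧ p.2 = p.1}

/-- The configuration space of two distinct labelled points on the Y-graph. -/
def Config : Set Pairs := {p | p.1 ∈ graph ∧ p.2 ∈ graph ∧ p.1 ≠ p.2}

/-- The index of a point of the Y-graph: `some i` on the `i`-th edge without the central vertex,
undefined (`none`) at the central vertex. -/
def index (x : Fin 3 → ℝ) : Option (Fin 3) :=
  if 0 < x 0 then some 0 else if 0 < x 1 then some 1 else if 0 < x 2 then some 2 else none

/-- The unfinned region (a punctured disc): the configurations whose two points do not have the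
same index, where an undefined index differs from a defined one. -/
def disc : Set Config := {p | index p.1.1 ≠ index p.1.2}

/-- The boundary of the disc: one of the two points is at an outer vertex. -/
def discBoundary : Set Config := {p | p ∈ disc ∧ (‖p.1.1‖ = 1 ∨ ‖p.1.2‖ = 1)}

/-- The circulating vector field. Addition of indices is modulo three. -/
def circulatingField (p : Config) : Pairs :=
  let x := p.1.1
  let y := p.1.2
  let a := ‖x‖
  let b := ‖y‖
  match index x, index y with
  | some i, some j =>
    if i = j then
      if a < b then (-b • e i, (b * (1 - b)) • e j)
      else ((a * (1 - a)) • e i, -a • e j)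
    else if i = j + 1 then
      if a < b then (b • e (j + 1), (b * (1 - b)) • e j)
      else ((a * (1 - a)) • e i, -a • e j)
    else -- here `j = i + 1`
      if a ≤ b then (-b • e i, (b * (1 - b)) • e j)
      else ((a * (1 - a)) • e i, a • e (i + 1))
  | none, some j => (b • e (j + 1), (b * (1 - b)) • e j)
  | some i, none => ((a * (1 - a)) • e i, a • e (i + 1))
  | none, none => 0 -- does not occur in the configuration space

/-- `X` is a piecewise-smooth vector field on the configuration space: its value at each point is
tangent to the space (lies in the contingent cone), and the space is the union of finitely many
cells, i.e. convex sets whose closures are polytopes, on each of which `X` is the restriction of a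
smooth map. -/
def IsPiecewiseSmoothVectorField (X : Config → Pairs) : Prop :=
  (∀ p : Config, X p ∈ posTangentConeAt Config (p : Pairs)) ∧
  ∃ (n : ℕ) (S : Fin n → Set Pairs) (F : Fin n → Pairs → Pairs),
    (⋃ k, S k) = Config ∧
    ∀ k, Convex ℝ (S k) ∧ (∃ V : Set Pairs, V.Finite ∧ closure (S k) = convexHull ℝ V) ∧
      ContDiff ℝ ∞ (F k) ∧ ∀ p : Config, (p : Pairs) ∈ S k → X p = F k p

/-- `γ` is a forward orbit of `X` on `[0, T)`: a continuous curve in the configuration space whose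
right derivative at every time is the value of `X`. -/
def IsForwardSolution (X : Config → Pairs) (T : ℝ) (γ : ℝ → Config) : Prop :=
  ContinuousOn γ (Ico 0 T) ∧
  ∀ t ∈ Ico 0 T, HasDerivWithinAt (fun s => (γ s : Pairs)) (X (γ t)) (Ici t) t

/-- `X` generates the (continuous) semiflow `φ`: the orbits of `φ` are forward orbits of `X`, and
forward orbits of `X` are unique. -/
def Generates (X : Config → Pairs) (φ : Flow ℝ≥0 Config) : Prop :=
  (∀ (p : Config) (T : ℝ), IsForwardSolution X T (fun t => φ t.toNNReal p)) ∧
  ∀ (T : ℝ) (γ : ℝ → Config), IsForwardSolution X T γ →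
    ∀ t ∈ Ico 0 T, γ t = φ t.toNNReal (γ 0)

/-- The set `A` of pairs is repelling for the semiflow `φ`: it has a neighbourhood `U` such that
all orbits which start off any prescribed neighbourhood of `A`, however small, are outside of `U`
from a common time on. -/
def IsRepelling (φ : Flow ℝ≥0 Config) (A : Set Pairs) : Prop :=
  ∃ U ∈ 𝓝ˢ A, ∀ V ∈ 𝓝ˢ A, ∃ T : ℝ≥0, ∀ p : Config, (p : Pairs) ∉ V →
    ∀ t ≥ T, (φ t p : Pairs) ∉ U

section Semiflow

variable {α : Type*} [TopologicalSpace α]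

/-- `Γ` is a (nonconstant) periodic orbit of `φ`. -/
def IsPeriodicOrbit (φ : Flow ℝ≥0 α) (Γ : Set α) : Prop :=
  ∃ p : α, (∃ T > 0, φ T p = p) ∧ (∃ t, φ t p ≠ p) ∧ Γ = range (fun t => φ t p)

/-- The orbit of `p` approaches `Γ`: it is eventually in each neighbourhood of `Γ` and accumulates
exactly at the points of `Γ`. -/
def Approaches (φ : Flow ℝ≥0 α) (p : α) (Γ : Set α) : Prop :=
  Tendsto (fun t => φ t p) atTop (𝓝ˢ Γ) ∧ omegaLimit atTop φ {p} = Γ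

/-- `Γ` is an attracting limit cycle: a periodic orbit which is the limit of some orbit that
starts off it, is stable, and is approached by all orbits that start near it. -/
def IsAttractingLimitCycle (φ : Flow ℝ≥0 α) (Γ : Set α) : Prop :=
  IsPeriodicOrbit φ Γ ∧
  (∃ q, q ∉ Γ ∧ Approaches φ q Γ) ∧
  (∀ V ∈ 𝓝ˢ Γ, ∃ W ∈ 𝓝ˢ Γ, ∀ p ∈ W, ∀ t, φ t p ∈ V) ∧
  (∃ W ∈ 𝓝ˢ Γ, ∀ p ∈ W, Approaches φ p Γ)

end Semiflow

end YGraph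

end

/-!
Call the point farther from the centre the leader, `M` its norm, and the other one the follower.
The field pushes the leader outward at the logistic rate `M * (1 - M)`, while the follower runs at
speed `M` through the centre towards the next edge. Let `v` be the position of the follower on the
segment formed by two edges, so that `|v| ≤ M`: in the coordinates `(M, v)` the field is
`(M * (1 - M), M)`, whose solutions are explicit. The leader and the follower exchange their roles
when their norms tie, and this takes at least a definite time, so that the pieces of solutions fit
together to a semiflow. Since `M` always solves the logistic equation, every orbit leaves the
diagonal, enters the disc in bounded time, and tends to the rim `M = 1`, on which the motion is a
rotation through six segments.
-/

noncomputable section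

namespace YGraph

/-! ### Charts of the configuration space -/

theorem ne_add_one (i : Fin 3) : i ≠ i + 1 := by decide +revert

theorem ne_add_one_add_one (i : Fin 3) : i ≠ i + 1 + 1 := by decide +revert

theorem eq_add_one_of_ne {i j : Fin 3} (h₁ : j ≠ i) (h₂ : j ≠ i + 1) : i = j + 1 := by
  decide +revert

theorem eq_add_two_of_ne {i j : Fin 3} (h₁ : j ≠ i) (h₂ : j ≠ i + 1) : j = i + 2 := by
  decide +revert

theorem smul_e_apply (s : ℝ) (i k : Fin 3) : (s • e i) k = if k = i then s else 0 := by
  by_cases h : k = i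
  · subst h; simp [e]
  · simp [e, h]

theorem e_ne_zero (i : Fin 3) : e i ≠ 0 := by simp [e]

theorem norm_smul_e (s : ℝ) (i : Fin 3) : ‖s • e i‖ = |s| := by
  rw [norm_smul, e, Pi.norm_single, norm_one, mul_one, Real.norm_eq_abs]

theorem smul_e_inj {s t : ℝ} {i j : Fin 3} (hs : s ≠ 0) (h : s • e i = t • e j) :
    i = j ∧ s = t := by
  have hi := congrFun h i
  rw [smul_e_apply, smul_e_apply, if_pos rfl] at hi
  by_cases hij : i = j
  · exact ⟨hij, by rwa [if_pos hij] at hi⟩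
  · exact absurd (by rwa [if_neg hij] at hi) hs

theorem index_zero : index 0 = none := by simp [index]

theorem index_smul_e {s : ℝ} (hs : 0 < s) (i : Fin 3) : index (s • e i) = some i := by
  simp only [index, smul_e_apply]
  fin_cases i <;> simp [hs]

theorem smul_e_mem_graph {s : ℝ} (i : Fin 3) (h0 : 0 ≤ s) (h1 : s ≤ 1) : s • e i ∈ graph :=
  ⟨i, s, ⟨h0, h1⟩, rfl⟩

theorem apply_mem_Icc_of_mem_graph {x : Fin 3 → ℝ} (hx : x ∈ graph) (i : Fin 3) :
    x i ∈ Icc (0 : ℝ) 1 := by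
  obtain ⟨k, s, hs, rfl⟩ := hx
  rw [smul_e_apply]
  split_ifs
  · exact hs
  · simp

theorem eq_smul_e_of_mem_graph {x : Fin 3 → ℝ} (hx : x ∈ graph) {i : Fin 3} (hi : x i ≠ 0) :
    x = x i • e i := by
  obtain ⟨k, s, -, rfl⟩ := hx
  rw [smul_e_apply] at hi
  by_cases h : i = k
  · subst h; rw [smul_e_apply, if_pos rfl]
  · simp [h] at hi

/-- The exchange of the two components of a pair if `r` is true, the identity otherwise. -/
def swapIf (r : Bool) : Pairs ≃L[ℝ] Pairs :=
  bif r then ContinuousLinearEquiv.prodComm ℝ _ _ else ContinuousLinearEquiv.refl ℝ _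

@[simp]
theorem swapIf_false (p : Pairs) : swapIf false p = p := rfl

@[simp]
theorem swapIf_true (p : Pairs) : swapIf true p = p.swap := rfl

theorem swapIf_swapIf (r : Bool) (p : Pairs) : swapIf r (swapIf r p) = p := by
  cases r <;> rfl

theorem norm_swapIf (r : Bool) (p : Pairs) : ‖swapIf r p‖ = ‖p‖ := by
  cases r
  · rfl
  · simp [Prod.norm_def, max_comm]

theorem swapIf_mem_Config (r : Bool) {p : Pairs} : swapIf r p ∈ Config ↔ p ∈ Config := by
  cases r
  · rfl
  · exact ⟨fun h => ⟨h.2.1, h.1, h.2.2.symm⟩, fun h => ⟨h.2.1, h.1, h.2.2.symm⟩⟩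

/-- The line formed by the edges `j` (negative parameters) and `i + 1` (nonnegative parameters),
which the second of two points follows while the first one is on the edge `i`. -/
def leg (i j : Fin 3) (v : ℝ) : Fin 3 → ℝ := max (-v) 0 • e j + max v 0 • e (i + 1)

theorem leg_of_nonpos (i j : Fin 3) {v : ℝ} (hv : v ≤ 0) : leg i j v = (-v) • e j := by
  rw [leg, max_eq_left (by linarith), max_eq_right hv, zero_smul, add_zero]

theorem leg_of_nonneg (i j : Fin 3) {v : ℝ} (hv : 0 ≤ v) : leg i j v = v • e (i + 1) := by
  rw [leg, max_eq_right (by linarith), max_eq_left hv, zero_smul, zero_add]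

theorem norm_leg (i j : Fin 3) (v : ℝ) : ‖leg i j v‖ = |v| := by
  rcases le_total v 0 with h | h
  · rw [leg_of_nonpos i j h, norm_smul_e, abs_neg]
  · rw [leg_of_nonneg i j h, norm_smul_e]

theorem leg_mem_graph (i j : Fin 3) {v : ℝ} (hv : |v| ≤ 1) : leg i j v ∈ graph := by
  obtain ⟨h₀, h₁⟩ := abs_le.1 hv
  rcases le_total v 0 with h | h
  · rw [leg_of_nonpos i j h]
    exact smul_e_mem_graph _ (by linarith) (by linarith)
  · rw [leg_of_nonneg i j h]
    exact smul_e_mem_graph _ h h₁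

/-- The pair of a leading point at distance `M` from the centre on the edge `i` and a following
point with coordinate `v` on the line `leg i j`; the leading point is the second component if `r`
is true. -/
def chart (r : Bool) (i j : Fin 3) (M v : ℝ) : Pairs := swapIf r (M • e i, leg i j v)

/-- The parameters at which `chart r i j` is a configuration: the leading point is at least as far
from the centre as the following one. -/
structure ChartDomain (i j : Fin 3) (M v : ℝ) : Prop where
  pos : 0 < M
  le_one : M ≤ 1
  neg_le : -M ≤ v
  le : v ≤ M
  ne : j ≠ i + 1
  neg_lt : j = i → -M < v

namespace ChartDomain

variable {i j : Fin 3} {M v : ℝ}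

theorem abs_le (h : ChartDomain i j M v) : |v| ≤ M := _root_.abs_le.2 ⟨h.neg_le, h.le⟩

end ChartDomain

theorem continuous_chart (r : Bool) (i j : Fin 3) :
    Continuous (fun q : ℝ × ℝ => chart r i j q.1 q.2) := by
  unfold chart leg
  fun_prop

theorem chart_of_nonpos (r : Bool) (i j : Fin 3) (M : ℝ) {v : ℝ} (hv : v ≤ 0) :
    chart r i j M v = swapIf r (M • e i, (-v) • e j) := by
  rw [chart, leg_of_nonpos i j hv]

theorem chart_of_nonneg (r : Bool) (i j : Fin 3) (M : ℝ) {v : ℝ} (hv : 0 ≤ v) :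
    chart r i j M v = swapIf r (M • e i, v • e (i + 1)) := by
  rw [chart, leg_of_nonneg i j hv]

theorem chart_tie (r : Bool) (i j : Fin 3) {M : ℝ} (hM : 0 ≤ M) :
    chart r i j M M = chart (!r) (i + 1) i M (-M) := by
  rw [chart_of_nonneg _ _ _ _ hM, chart_of_nonpos _ _ _ _ (neg_nonpos.2 hM), neg_neg]
  cases r <;> rfl

theorem norm_chart (r : Bool) (i j : Fin 3) {M v : ℝ} (h : |v| ≤ M) : ‖chart r i j M v‖ = M := by
  rw [chart, norm_swapIf, Prod.norm_def, norm_smul_e, norm_leg, abs_of_nonneg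
    ((abs_nonneg v).trans h), max_eq_left h]

theorem chart_mem_Config (r : Bool) {i j : Fin 3} {M v : ℝ} (h : ChartDomain i j M v) :
    chart r i j M v ∈ Config := by
  refine (swapIf_mem_Config r).2 ⟨smul_e_mem_graph i h.pos.le h.le_one,
    leg_mem_graph i j (h.abs_le.trans h.le_one), fun heq => ?_⟩
  rcases le_total v 0 with hv | hv
  · obtain ⟨hij, hM⟩ := smul_e_inj h.pos.ne' (heq.trans (leg_of_nonpos i j hv))
    linarith [h.neg_lt hij.symm]
  · simpa using (smul_e_inj h.pos.ne' (heq.trans (leg_of_nonneg i j hv))).1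

theorem exists_chart_of_le (r : Bool) {i k : Fin 3} {a b : ℝ} (ha : 0 < a) (ha₁ : a ≤ 1)
    (hb : 0 ≤ b) (hba : b ≤ a) (hk : k = i → b < a) :
    ∃ r' i' j v, ChartDomain i' j a v ∧ v < a ∧
      swapIf r (a • e i, b • e k) = chart r' i' j a v := by
  by_cases hki : k = i + 1
  · subst hki
    rcases hba.lt_or_eq with hlt | rfl
    · exact ⟨r, i, i, b, ⟨ha, ha₁, by linarith, hba, by simp, fun _ => by linarith⟩, hlt,
        (chart_of_nonneg r i i a hb).symm⟩
    · refine ⟨!r, i + 1, i, -b, ⟨ha, ha₁, le_rfl, by linarith, ne_add_one_add_one i, by simp⟩,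
        by linarith, ?_⟩
      rw [← chart_tie r i i hb, chart_of_nonneg r i i b hb]
  · refine ⟨r, i, k, -b, ⟨ha, ha₁, by linarith, by linarith, hki, fun h => by linarith [hk h]⟩,
      by linarith, ?_⟩
    rw [chart_of_nonpos _ _ _ _ (neg_nonpos.2 hb), neg_neg]

/-- The charts with `v < M` cover the configuration space: a tie is counted as the start of the
motion in the next chart (`chart_tie`). -/
theorem exists_chart {p : Pairs} (hp : p ∈ Config) :
    ∃ r i j M v, ChartDomain i j M v ∧ v < M ∧ p = chart r i j M v := by
  obtain ⟨x, y⟩ := p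
  obtain ⟨⟨i, a, ⟨ha₀, ha₁⟩, rfl : x = _⟩, ⟨k, b, ⟨hb₀, hb₁⟩, rfl : y = _⟩, hne⟩ := hp
  have hpos : a ≠ b ∨ 0 < a := by
    by_contra! h
    obtain rfl : a = 0 := le_antisymm h.2 ha₀
    exact hne (by simp [← h.1])
  rcases le_total b a with hba | hab
  · obtain ⟨r', i', j, v, h⟩ := exists_chart_of_le false (i := i) (k := k)
      (hpos.elim (fun h => hb₀.trans_lt (hba.lt_of_ne' h)) id) ha₁ hb₀ hba
      (fun hki => hba.lt_of_ne (fun hab => hne (by rw [hki, hab])))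
    exact ⟨r', i', j, a, v, h⟩
  · obtain ⟨r', i', j, v, h⟩ := exists_chart_of_le true (i := k) (k := i)
      (hpos.elim (fun h => ha₀.trans_lt (hab.lt_of_ne h)) (·.trans_le hab)) hb₁ ha₀ hab
      (fun hik => hab.lt_of_ne (fun hab => hne (by rw [hik, hab])))
    exact ⟨r', i', j, b, v, h⟩

theorem norm_mem_Ioc_of_mem_Config {p : Pairs} (hp : p ∈ Config) : ‖p‖ ∈ Ioc (0 : ℝ) 1 := by
  obtain ⟨r, i, j, M, v, h, -, rfl⟩ := exists_chart hp
  rw [norm_chart r i j h.abs_le]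
  exact ⟨h.pos, h.le_one⟩

theorem chartDomain_of_chart_mem_Config {r : Bool} {i j : Fin 3} {M v : ℝ} (hj : j ≠ i + 1)
    (hvM : |v| ≤ M) (h : chart r i j M v ∈ Config) : ChartDomain i j M v := by
  obtain ⟨hM, hM₁⟩ := norm_mem_Ioc_of_mem_Config h
  rw [norm_chart r i j hvM] at hM hM₁
  obtain ⟨hneg, hle⟩ := abs_le.1 hvM
  refine ⟨hM, hM₁, hneg, hle, hj, fun hji => hneg.lt_of_ne ?_⟩
  rintro rfl
  rw [chart_of_nonpos _ _ _ _ (neg_nonpos.2 hM.le), neg_neg, hji, swapIf_mem_Config] at h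
  exact h.2.2 rfl

/-- The linear map that reads off the parameters of `chart r i j`. -/
def coords (r : Bool) (i j : Fin 3) : Pairs →L[ℝ] ℝ × ℝ :=
  let x (k : Fin 3) : Pairs →L[ℝ] ℝ :=
    .proj k ∘L .fst ℝ _ _ ∘L (swapIf r : Pairs →L[ℝ] Pairs)
  let y (k : Fin 3) : Pairs →L[ℝ] ℝ :=
    .proj k ∘L .snd ℝ _ _ ∘L (swapIf r : Pairs →L[ℝ] Pairs)
  (x i).prod (y (i + 1) - y j)

theorem coords_apply (r : Bool) (i j : Fin 3) (p : Pairs) :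
    coords r i j p = ((swapIf r p).1 i, (swapIf r p).2 (i + 1) - (swapIf r p).2 j) := rfl

theorem coords_swapIf (r : Bool) (i j : Fin 3) (x y : Fin 3 → ℝ) :
    coords r i j (swapIf r (x, y)) = (x i, y (i + 1) - y j) := by
  rw [coords_apply, swapIf_swapIf]

theorem coords_chart (r : Bool) {i j : Fin 3} (hj : j ≠ i + 1) (M v : ℝ) :
    coords r i j (chart r i j M v) = (M, v) := by
  rw [chart, coords_swapIf]
  simp [leg, e, hj, hj.symm]

theorem eq_chart_of_coords {r : Bool} {i j : Fin 3} (hj : j ≠ i + 1) {p : Pairs} (hp : p ∈ Config)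
    {M v : ℝ} (hc : coords r i j p = (M, v)) (hM : M ≠ 0) (hv₀ : v ≠ 0) :
    p = chart r i j M v := by
  obtain ⟨q, rfl⟩ : ∃ q, p = swapIf r q := ⟨swapIf r p, (swapIf_swapIf r p).symm⟩
  obtain ⟨x, y⟩ := q
  obtain ⟨hx, ⟨k, s, ⟨hs, -⟩, rfl : y = s • e k⟩, -⟩ := (swapIf_mem_Config r).1 hp
  rw [coords_swapIf, Prod.mk.injEq] at hc
  obtain ⟨rfl : x i = M, hv⟩ := hc
  have hleg : s • e k = leg i j v := by
    rw [smul_e_apply, smul_e_apply] at hv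
    split_ifs at hv with h₁ h₂ h₂
    · exact absurd (h₂.trans h₁.symm) hj
    · rw [leg_of_nonneg i j (by linarith), ← h₁, ← hv, sub_zero]
    · rw [leg_of_nonpos i j (by linarith), ← h₂, ← hv, zero_sub, neg_neg]
    · exact absurd (by linarith) hv₀
  rw [chart, ← hleg, ← eq_smul_e_of_mem_graph hx hM]

/-! ### The field in a chart -/

theorem circulatingField_smul_e {a b : ℝ} (ha : 0 < a) (hb : 0 < b) {i j : Fin 3} {p : Config}
    (hp : (p : Pairs) = (a • e i, b • e j)) :
    circulatingField p =
      if i = j then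
        if a < b then (-b • e i, (b * (1 - b)) • e j)
        else ((a * (1 - a)) • e i, -a • e j)
      else if i = j + 1 then
        if a < b then (b • e (j + 1), (b * (1 - b)) • e j)
        else ((a * (1 - a)) • e i, -a • e j)
      else
        if a ≤ b then (-b • e i, (b * (1 - b)) • e j)
        else ((a * (1 - a)) • e i, a • e (i + 1)) := by
  simp only [circulatingField, hp, index_smul_e ha, index_smul_e hb, norm_smul_e, abs_of_pos ha,
    abs_of_pos hb]

theorem circulatingField_chart_of_neg {r : Bool} {i j : Fin 3} {M v : ℝ} (h : ChartDomain i j M v)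
    (hv : v < 0) {p : Config} (hp : (p : Pairs) = chart r i j M v) :
    circulatingField p = swapIf r ((M * (1 - M)) • e i, (-M) • e j) := by
  have hv' := neg_pos.2 hv
  have hM := h.pos
  have hMv := h.neg_le
  have hlt := h.neg_lt
  have hji : j ≠ i → i = j + 1 := fun h' => eq_add_one_of_ne h' h.ne
  rw [chart_of_nonpos _ _ _ _ hv.le] at hp
  cases r
  · rw [circulatingField_smul_e hM hv' hp]
    split_ifs <;> first | rfl | grind
  · rw [circulatingField_smul_e hv' hM hp]
    split_ifs <;> first | rfl | grind [h.ne]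

theorem circulatingField_chart_of_nonneg {r : Bool} {i j : Fin 3} {M v : ℝ}
    (h : ChartDomain i j M v) (hv : 0 ≤ v) (hvM : v < M) {p : Config}
    (hp : (p : Pairs) = chart r i j M v) :
    circulatingField p = swapIf r ((M * (1 - M)) • e i, M • e (i + 1)) := by
  have hM := h.pos
  rw [chart_of_nonneg _ _ _ _ hv] at hp
  rcases hv.eq_or_lt with rfl | hv
  · rw [zero_smul] at hp
    cases r <;> simp [circulatingField, hp, index_smul_e hM, index_zero, norm_smul_e,
      abs_of_pos hM, -Pi.smul_apply]
  · cases r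
    · rw [circulatingField_smul_e hM hv hp, if_neg (ne_add_one i), if_neg (ne_add_one_add_one i),
        if_neg hvM.not_ge]
      rfl
    · rw [circulatingField_smul_e hv hM hp, if_neg (ne_add_one i).symm, if_pos rfl, if_pos hvM]
      rfl

theorem circulatingField_chart {r : Bool} {i j : Fin 3} {M v : ℝ} (h : ChartDomain i j M v)
    (hv : v < M) {p : Config} (hp : (p : Pairs) = chart r i j M v) :
    circulatingField p =
      swapIf r ((M * (1 - M)) • e i, if v < 0 then (-M) • e j else M • e (i + 1)) := by
  split_ifs with h₀
  · exact circulatingField_chart_of_neg h h₀ hp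
  · exact circulatingField_chart_of_nonneg h (not_lt.1 h₀) hv hp

theorem circulatingField_ne_zero (p : Config) : circulatingField p ≠ 0 := by
  obtain ⟨r, i, j, M, v, h, hv, hp⟩ := exists_chart p.2
  rw [circulatingField_chart h hv hp, Ne, (swapIf r).map_eq_zero_iff, Prod.mk_eq_zero, not_and]
  intro _
  split_ifs <;> simp [e_ne_zero, h.pos.ne']

/-- The circulating field in the coordinates `(M, v)` of any chart. -/
def chartField (q : ℝ × ℝ) : ℝ × ℝ := (q.1 * (1 - q.1), q.1)

theorem coords_circulatingField {r : Bool} {i j : Fin 3} {M v : ℝ} (h : ChartDomain i j M v)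
    (hv : v < M) {p : Config} (hp : (p : Pairs) = chart r i j M v) :
    coords r i j (circulatingField p) = chartField (M, v) := by
  rw [circulatingField_chart h hv hp, coords_swapIf]
  have := h.ne
  split_ifs <;> simp [chartField, e, this, this.symm]

/-! ### The logistic motion -/

/-- The denominator of the solution `growth` of the logistic equation. -/
def denom (M t : ℝ) : ℝ := 1 + M * (Real.exp t - 1)

/-- The solution of the logistic equation `M' = M (1 - M)` with initial value `M`. -/
def growth (M t : ℝ) : ℝ := M * Real.exp t / denom M t

/-- The distance covered up to time `t` at the speed `growth M`. -/
def travel (M t : ℝ) : ℝ := Real.log (denom M t)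

theorem one_le_denom {M t : ℝ} (hM : 0 ≤ M) (ht : 0 ≤ t) : 1 ≤ denom M t := by
  have : 1 ≤ Real.exp t := Real.one_le_exp ht
  unfold denom
  nlinarith

theorem denom_pos {M t : ℝ} (hM : 0 ≤ M) (ht : 0 ≤ t) : 0 < denom M t :=
  zero_lt_one.trans_le (one_le_denom hM ht)

theorem denom_zero (M : ℝ) : denom M 0 = 1 := by simp [denom]

theorem denom_one (t : ℝ) : denom 1 t = Real.exp t := by simp [denom]

theorem growth_zero (M : ℝ) : growth M 0 = M := by simp [growth, denom_zero]

theorem travel_zero (M : ℝ) : travel M 0 = 0 := by simp [travel, denom_zero]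

theorem growth_one (t : ℝ) : growth 1 t = 1 := by simp [growth, denom_one]

theorem travel_one (t : ℝ) : travel 1 t = t := by simp [travel, denom_one]

theorem growth_pos {M t : ℝ} (hM : 0 < M) (ht : 0 ≤ t) : 0 < growth M t :=
  div_pos (mul_pos hM (Real.exp_pos t)) (denom_pos hM.le ht)

theorem growth_le_one {M t : ℝ} (hM : 0 ≤ M) (hM₁ : M ≤ 1) (ht : 0 ≤ t) : growth M t ≤ 1 := by
  rw [growth, div_le_one (denom_pos hM ht)]
  unfold denom
  linarith

theorem growth_add {M s t : ℝ} (hM : 0 < M) (hs : 0 ≤ s) (ht : 0 ≤ t) :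
    growth (growth M s) t = growth M (s + t) := by
  have hds := denom_pos hM.le hs
  have hd : denom (growth M s) t = denom M (s + t) / denom M s := by
    rw [eq_div_iff hds.ne', denom, growth, add_mul, mul_right_comm, div_mul_cancel₀ _ hds.ne',
      denom, denom, Real.exp_add]
    ring
  have hdst := denom_pos hM.le (add_nonneg hs ht)
  rw [growth, hd, growth, growth, Real.exp_add]
  field_simp

theorem hasDerivAt_denom (M t : ℝ) : HasDerivAt (denom M) (M * Real.exp t) t :=
  (((Real.hasDerivAt_exp t).sub_const 1).const_mul M).const_add 1

theorem hasDerivAt_travel {M t : ℝ} (hM : 0 ≤ M) (ht : 0 ≤ t) :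
    HasDerivAt (travel M) (growth M t) t :=
  (hasDerivAt_denom M t).log (denom_pos hM ht).ne'

theorem hasDerivAt_growth {M t : ℝ} (hM : 0 ≤ M) (ht : 0 ≤ t) :
    HasDerivAt (growth M) (growth M t * (1 - growth M t)) t := by
  have hd := denom_pos hM ht
  refine (((Real.hasDerivAt_exp t).const_mul M).div (hasDerivAt_denom M t) hd.ne').congr_deriv ?_
  unfold growth
  field_simp

theorem travel_mono {M s t : ℝ} (hM : 0 ≤ M) (hs : 0 ≤ s) (hst : s ≤ t) :
    travel M s ≤ travel M t := by
  refine Real.log_le_log (denom_pos hM hs) ?_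
  unfold denom
  gcongr

theorem travel_nonneg {M t : ℝ} (hM : 0 ≤ M) (ht : 0 ≤ t) : 0 ≤ travel M t :=
  Real.log_nonneg (one_le_denom hM ht)

theorem growth_mono {M s t : ℝ} (hM : 0 ≤ M) (hM₁ : M ≤ 1) (hs : 0 ≤ s) (hst : s ≤ t) :
    growth M s ≤ growth M t := by
  rw [growth, growth, div_le_div_iff₀ (denom_pos hM hs) (denom_pos hM (hs.trans hst))]
  have hexp := Real.exp_le_exp.2 hst
  unfold denom
  nlinarith [mul_nonneg (mul_nonneg hM (sub_nonneg.2 hM₁)) (sub_nonneg.2 hexp)]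

theorem le_growth {M t : ℝ} (hM : 0 ≤ M) (hM₁ : M ≤ 1) (ht : 0 ≤ t) : M ≤ growth M t := by
  simpa only [growth_zero] using growth_mono hM hM₁ le_rfl ht

theorem growth_mono_left {M N t : ℝ} (hM : 0 ≤ M) (hMN : M ≤ N) (ht : 0 ≤ t) :
    growth M t ≤ growth N t := by
  rw [growth, growth, div_le_div_iff₀ (denom_pos hM ht) (denom_pos (hM.trans hMN) ht)]
  unfold denom
  nlinarith [Real.exp_pos t]

theorem travel_sub_travel_le {M s t : ℝ} (hM : 0 ≤ M) (hs : 0 ≤ s) (ht : 0 ≤ t) :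
    travel M t - travel M s ≤ growth M s * (Real.exp (t - s) - 1) := by
  have hds := denom_pos hM hs
  have hdt := denom_pos hM ht
  calc travel M t - travel M s = Real.log (denom M t / denom M s) :=
        (Real.log_div hdt.ne' hds.ne').symm
    _ ≤ denom M t / denom M s - 1 := Real.log_le_sub_one_of_pos (div_pos hdt hds)
    _ = growth M s * (Real.exp (t - s) - 1) := by
        rw [growth, Real.exp_sub]
        field_simp
        unfold denom
        ring

theorem le_travel_one {M : ℝ} (hM : 0 ≤ M) (hM₁ : M ≤ 1) : M ≤ travel M 1 := by
  rw [travel, Real.le_log_iff_exp_le (denom_pos hM zero_le_one)]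
  have hconv := convexOn_exp.2 (mem_univ (0 : ℝ)) (mem_univ (1 : ℝ)) (sub_nonneg.2 hM₁) hM
    (sub_add_cancel 1 M)
  simp only [smul_eq_mul, mul_zero, mul_one, zero_add, Real.exp_zero] at hconv
  unfold denom
  linarith

theorem tendsto_denom {M : ℝ} (hM : 0 < M) : Tendsto (denom M) atTop atTop :=
  tendsto_atTop_add_const_left _ _
    ((tendsto_atTop_add_const_right _ _ Real.tendsto_exp_atTop).const_mul_atTop hM)

theorem tendsto_travel {M : ℝ} (hM : 0 < M) : Tendsto (travel M) atTop atTop :=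
  Real.tendsto_log_atTop.comp (tendsto_denom hM)

theorem tendsto_growth {M : ℝ} (hM : 0 < M) : Tendsto (growth M) atTop (𝓝 1) := by
  have hlim : Tendsto (fun t => 1 - (1 - M) / denom M t) atTop (𝓝 (1 - 0)) :=
    ((tendsto_denom hM).const_div_atTop (1 - M)).const_sub 1
  rw [sub_zero] at hlim
  refine hlim.congr' ?_
  filter_upwards [eventually_ge_atTop 0] with t ht
  rw [growth, eq_div_iff (denom_pos hM.le ht).ne', sub_mul, div_mul_cancel₀ _
    (denom_pos hM.le ht).ne', denom]
  ring

section Continuity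

variable {X : Type*} [TopologicalSpace X] {M t : X → ℝ}

theorem continuous_denom (hM : Continuous M) (ht : Continuous t) :
    Continuous fun x => denom (M x) (t x) := by
  unfold denom
  fun_prop

theorem continuous_growth (hM : Continuous M) (ht : Continuous t) (hM₀ : ∀ x, 0 ≤ M x)
    (ht₀ : ∀ x, 0 ≤ t x) : Continuous fun x => growth (M x) (t x) :=
  (hM.mul (Real.continuous_exp.comp ht)).div (continuous_denom hM ht)
    fun x => (denom_pos (hM₀ x) (ht₀ x)).ne'

theorem continuous_travel (hM : Continuous M) (ht : Continuous t) (hM₀ : ∀ x, 0 ≤ M x)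
    (ht₀ : ∀ x, 0 ≤ t x) : Continuous fun x => travel (M x) (t x) :=
  (continuous_denom hM ht).log fun x => (denom_pos (hM₀ x) (ht₀ x)).ne'

end Continuity

/-! ### The pursuit of the leading point -/

/-- The coordinate of the following point minus that of the leading point, from the parameters
`M` and `v` of a chart on. -/
def gap (M v t : ℝ) : ℝ := v + travel M t - growth M t

theorem hasDerivAt_gap {M t : ℝ} (v : ℝ) (hM : 0 ≤ M) (ht : 0 ≤ t) :
    HasDerivAt (gap M v) (growth M t ^ 2) t :=
  (((hasDerivAt_travel hM ht).const_add v).sub (hasDerivAt_growth hM ht)).congr_deriv (by ring)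

theorem continuousOn_gap {M : ℝ} (v : ℝ) (hM : 0 ≤ M) : ContinuousOn (gap M v) (Ici 0) :=
  fun _ ht => (hasDerivAt_gap v hM ht).continuousAt.continuousWithinAt

theorem strictMonoOn_gap {M : ℝ} (v : ℝ) (hM : 0 < M) : StrictMonoOn (gap M v) (Ici 0) := by
  refine strictMonoOn_of_deriv_pos (convex_Ici 0) (continuousOn_gap v hM.le) fun t ht => ?_
  rw [interior_Ici] at ht
  rw [(hasDerivAt_gap v hM.le (le_of_lt ht)).deriv]
  exact pow_pos (growth_pos hM (le_of_lt ht)) 2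

theorem tendsto_gap {M : ℝ} (v : ℝ) (hM : 0 < M) : Tendsto (gap M v) atTop atTop :=
  (tendsto_atTop_add_const_left _ v (tendsto_travel hM)).atTop_add (tendsto_growth hM).neg

theorem exists_gap_eq_zero {M v : ℝ} (hM : 0 < M) (hv : v ≤ M) : ∃ t, 0 ≤ t ∧ gap M v t = 0 := by
  obtain ⟨T, hT, hT₀⟩ := (((tendsto_gap v hM).eventually_ge_atTop 0).and
    (eventually_ge_atTop 0)).exists
  have h₀ : gap M v 0 ≤ 0 := by simpa [gap, travel_zero, growth_zero] using hv
  obtain ⟨t, ht, hgap⟩ := intermediate_value_Icc hT₀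
    ((continuousOn_gap v hM.le).mono Icc_subset_Ici_self) ⟨h₀, hT⟩
  exact ⟨t, ht.1, hgap⟩

/-- The time at which the following point is as far from the centre as the leading one. -/
def hit (M v : ℝ) : ℝ := sInf {t | 0 ≤ t ∧ 0 ≤ gap M v t}

theorem hit_nonneg (M v : ℝ) : 0 ≤ hit M v := Real.sInf_nonneg fun _ ht => ht.1

theorem gap_hit {M v : ℝ} (hM : 0 < M) (hv : v ≤ M) : gap M v (hit M v) = 0 := by
  obtain ⟨t, ht, hgap⟩ := exists_gap_eq_zero hM hv
  have hleast : IsLeast {t | 0 ≤ t ∧ 0 ≤ gap M v t} t :=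
    ⟨⟨ht, hgap.ge⟩, fun s hs => ((strictMonoOn_gap v hM).le_iff_le ht hs.1).1 (hgap.trans_le hs.2)⟩
  rw [hit, hleast.csInf_eq, hgap]

theorem gap_neg_iff {M v t : ℝ} (hM : 0 < M) (hv : v ≤ M) (ht : 0 ≤ t) :
    gap M v t < 0 ↔ t < hit M v := by
  rw [← gap_hit hM hv]
  exact (strictMonoOn_gap v hM).lt_iff_lt ht (hit_nonneg M v)

theorem gap_pos_iff {M v t : ℝ} (hM : 0 < M) (hv : v ≤ M) (ht : 0 ≤ t) :
    0 < gap M v t ↔ hit M v < t := by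
  rw [← gap_hit hM hv]
  exact (strictMonoOn_gap v hM).lt_iff_lt (hit_nonneg M v) ht

theorem continuous_hit {X : Type*} [TopologicalSpace X] {M v : X → ℝ} (hM : Continuous M)
    (hv : Continuous v) (hM₀ : ∀ x, 0 < M x) (hvM : ∀ x, v x ≤ M x) :
    Continuous fun x => hit (M x) (v x) := by
  have hgap : ∀ t : ℝ, 0 ≤ t → Continuous fun x => gap (M x) (v x) t := fun t ht =>
    (hv.add (continuous_travel hM continuous_const (fun x => (hM₀ x).le) fun _ => ht)).sub
      (continuous_growth hM continuous_const (fun x => (hM₀ x).le) fun _ => ht)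
  refine continuous_iff_continuousAt.2 fun x => tendsto_order.2 ⟨fun c hc => ?_, fun c hc => ?_⟩
  · rcases lt_or_ge c 0 with h₀ | h₀
    · exact Eventually.of_forall fun y => h₀.trans_le (hit_nonneg _ _)
    · filter_upwards [(hgap c h₀).continuousAt.eventually_lt_const
        ((gap_neg_iff (hM₀ x) (hvM x) h₀).2 hc)] with y hy
      exact (gap_neg_iff (hM₀ y) (hvM y) h₀).1 hy
  · have h₀ : 0 ≤ c := (hit_nonneg _ _).trans hc.le
    filter_upwards [(hgap c h₀).continuousAt.eventually_const_lt
      ((gap_pos_iff (hM₀ x) (hvM x) h₀).2 hc)] with y hy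
    exact (gap_pos_iff (hM₀ y) (hvM y) h₀).1 hy

/-- The position at time `t` of the orbit that starts at `chart r i j M v`, valid until the second
exchange of the leading point. -/
def run (r : Bool) (i j : Fin 3) (M v t : ℝ) : Pairs :=
  if t ≤ hit M v then chart r i j (growth M t) (v + travel M t)
  else chart (!r) (i + 1) i (growth M t) (v + travel M t - 2 * growth M (hit M v))

theorem run_of_le {r : Bool} {i j : Fin 3} {M v t : ℝ} (ht : t ≤ hit M v) :
    run r i j M v t = chart r i j (growth M t) (v + travel M t) := if_pos ht

theorem run_zero (r : Bool) (i j : Fin 3) (M v : ℝ) : run r i j M v 0 = chart r i j M v := by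
  rw [run_of_le (hit_nonneg M v), growth_zero, travel_zero, add_zero]

theorem chart_hit (r : Bool) (i j : Fin 3) {M v : ℝ} (hM : 0 < M) (hv : v ≤ M) :
    chart r i j (growth M (hit M v)) (v + travel M (hit M v)) =
      chart (!r) (i + 1) i (growth M (hit M v))
        (v + travel M (hit M v) - 2 * growth M (hit M v)) := by
  rw [sub_eq_zero.1 (gap_hit hM hv), chart_tie r i j (growth_pos hM (hit_nonneg M v)).le]
  congr 1
  ring

theorem run_of_ge {r : Bool} {i j : Fin 3} {M v t : ℝ} (hM : 0 < M) (hv : v ≤ M)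
    (ht : hit M v ≤ t) :
    run r i j M v t =
      chart (!r) (i + 1) i (growth M t) (v + travel M t - 2 * growth M (hit M v)) := by
  rcases ht.eq_or_lt with h | h
  · rw [run_of_le h.ge, ← h, chart_hit r i j hM hv]
  · rw [run, if_neg (not_le.2 h)]

namespace ChartDomain

variable {i j : Fin 3} {M v t : ℝ}

theorem before_hit (h : ChartDomain i j M v) (h₀ : 0 ≤ t) (ht : t ≤ hit M v) :
    ChartDomain i j (growth M t) (v + travel M t) where
  pos := growth_pos h.pos h₀
  le_one := growth_le_one h.pos.le h.le_one h₀
  neg_le := by linarith [h.neg_le, le_growth h.pos.le h.le_one h₀, travel_nonneg h.pos.le h₀]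
  le := sub_nonpos.1 (not_lt.1 ((gap_pos_iff h.pos h.le h₀).not.2 ht.not_gt))
  ne := h.ne
  neg_lt hj := by linarith [h.neg_lt hj, le_growth h.pos.le h.le_one h₀, travel_nonneg h.pos.le h₀]

/-- The follower needs at least the time `log 3` to catch up again: this is the limit of the time
between two exchanges as `M` tends to `0`. -/
theorem lt_growth_after_hit (h : ChartDomain i j M v) (ht : hit M v ≤ t)
    (ht' : t < hit M v + Real.log 3) :
    v + travel M t - 2 * growth M (hit M v) < growth M t := by
  have h₀ := hit_nonneg M v
  have hgap := sub_eq_zero.1 (gap_hit h.pos h.le)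
  have hmono := growth_mono h.pos.le h.le_one h₀ ht
  have htravel := travel_sub_travel_le h.pos.le h₀ (h₀.trans ht)
  have hexp : Real.exp (t - hit M v) < 3 := by
    rw [← Real.lt_log_iff_exp_lt (by norm_num)]
    linarith
  nlinarith [growth_pos h.pos h₀]

theorem after_hit (h : ChartDomain i j M v) (ht : hit M v ≤ t) (ht' : t < hit M v + Real.log 3) :
    ChartDomain (i + 1) i (growth M t) (v + travel M t - 2 * growth M (hit M v)) where
  pos := growth_pos h.pos ((hit_nonneg M v).trans ht)
  le_one := growth_le_one h.pos.le h.le_one ((hit_nonneg M v).trans ht)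
  neg_le := by
    linarith [sub_eq_zero.1 (gap_hit h.pos h.le), travel_mono h.pos.le (hit_nonneg M v) ht,
      growth_mono h.pos.le h.le_one (hit_nonneg M v) ht]
  le := (h.lt_growth_after_hit ht ht').le
  ne := ne_add_one_add_one i
  neg_lt hi := absurd hi (ne_add_one i)

end ChartDomain

theorem one_lt_log_three : 1 < Real.log 3 :=
  (Real.lt_log_iff_exp_lt (by norm_num)).2 Real.exp_one_lt_three

theorem run_mem_Config (r : Bool) {i j : Fin 3} {M v t : ℝ} (h : ChartDomain i j M v)
    (h₀ : 0 ≤ t) (ht : t < Real.log 3) : run r i j M v t ∈ Config := by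
  rcases le_total t (hit M v) with hle | hge
  · rw [run_of_le hle]
    exact chart_mem_Config r (h.before_hit h₀ hle)
  · rw [run_of_ge h.pos h.le hge]
    exact chart_mem_Config _ (h.after_hit hge (by linarith [hit_nonneg M v]))

theorem norm_run (r : Bool) {i j : Fin 3} {M v t : ℝ} (h : ChartDomain i j M v) (h₀ : 0 ≤ t)
    (ht : t < Real.log 3) : ‖run r i j M v t‖ = growth M t := by
  rcases le_total t (hit M v) with hle | hge
  · rw [run_of_le hle, norm_chart r i j (h.before_hit h₀ hle).abs_le]
  · rw [run_of_ge h.pos h.le hge, norm_chart _ _ _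
      (h.after_hit hge (by linarith [hit_nonneg M v])).abs_le]

theorem continuous_run (r : Bool) (i j : Fin 3) {X : Type*} [TopologicalSpace X] {M v t : X → ℝ}
    (hM : Continuous M) (hv : Continuous v) (ht : Continuous t) (hM₀ : ∀ x, 0 < M x)
    (hvM : ∀ x, v x ≤ M x) (ht₀ : ∀ x, 0 ≤ t x) :
    Continuous fun x => run r i j (M x) (v x) (t x) := by
  have hhit := continuous_hit hM hv hM₀ hvM
  have hgrowth := continuous_growth hM ht (fun x => (hM₀ x).le) ht₀
  have htravel := continuous_travel hM ht (fun x => (hM₀ x).le) ht₀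
  have hgrowth_hit := continuous_growth hM hhit (fun x => (hM₀ x).le) fun x => hit_nonneg _ _
  refine Continuous.if_le ?_ ?_ ht hhit fun x hx => ?_
  · exact (continuous_chart r i j).comp (hgrowth.prodMk (hv.add htravel))
  · exact (continuous_chart (!r) (i + 1) i).comp
      (hgrowth.prodMk ((hv.add htravel).sub (continuous_const.mul hgrowth_hit)))
  · rw [hx]
    exact chart_hit r i j (hM₀ x) (hvM x)

/-! ### Uniqueness of forward orbits -/

theorem hasDerivWithinAt_comp_add_const {E : Type*} [NormedAddCommGroup E] [NormedSpace ℝ E]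
    {f : ℝ → E} {f' : E} {a t : ℝ} (h : HasDerivWithinAt f f' (Ici (t + a)) (t + a)) :
    HasDerivWithinAt (fun s => f (s + a)) f' (Ici t) t := by
  simpa using! h.scomp t ((hasDerivWithinAt_id t (Ici t)).add_const a)
    fun s hs => add_le_add_left (mem_Ici.1 hs) a

theorem eventually_nhdsGT_lt_of_hasDerivWithinAt {f : ℝ → ℝ} {f' t : ℝ}
    (h : HasDerivWithinAt f f' (Ici t) t) (hf' : 0 < f') : ∀ᶠ s in 𝓝[>] t, f t < f s := by
  have hslope := hasDerivWithinAt_iff_tendsto_slope.1 h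
  rw [Ici_sdiff_left] at hslope
  filter_upwards [hslope.eventually_const_lt hf', self_mem_nhdsWithin] with s hs hts
  rw [slope_def_field, div_pos_iff_of_pos_right (sub_pos.2 hts)] at hs
  exact sub_pos.1 hs

namespace IsForwardSolution

section General

variable {X : Config → Pairs} {T : ℝ} {γ : ℝ → Config}

theorem mono (hγ : IsForwardSolution X T γ) {T' : ℝ} (hT' : T' ≤ T) : IsForwardSolution X T' γ :=
  ⟨hγ.1.mono (Ico_subset_Ico_right hT'), fun t ht => hγ.2 t (Ico_subset_Ico_right hT' ht)⟩

theorem congr (hγ : IsForwardSolution X T γ) {γ' : ℝ → Config} (h : EqOn γ' γ (Ico 0 T)) :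
    IsForwardSolution X T γ' := by
  refine ⟨hγ.1.congr h, fun t ht => ?_⟩
  rw [h ht]
  refine (hγ.2 t ht).congr_of_eventuallyEq ?_ (congrArg Subtype.val (h ht))
  filter_upwards [Ico_mem_nhdsGE ht.2] with s hs
  exact congrArg Subtype.val (h ⟨ht.1.trans hs.1, hs.2⟩)

theorem shift (hγ : IsForwardSolution X T γ) {a : ℝ} (ha : 0 ≤ a) :
    IsForwardSolution X (T - a) (fun s => γ (s + a)) := by
  have hmaps : MapsTo (· + a) (Ico 0 (T - a)) (Ico 0 T) := fun t ht =>
    ⟨add_nonneg ht.1 ha, lt_sub_iff_add_lt.1 ht.2⟩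
  exact ⟨hγ.1.comp (by fun_prop) hmaps,
    fun t ht => hasDerivWithinAt_comp_add_const (f := fun s => (γ s : Pairs)) (hγ.2 _ (hmaps ht))⟩

end General

variable {T : ℝ} {γ : ℝ → Config} {t₀ : ℝ} {r : Bool} {i j : Fin 3} {M v : ℝ}

theorem hasDerivWithinAt_coords (hγ : IsForwardSolution circulatingField T γ) (ht₀ : t₀ ∈ Ico 0 T)
    (h : ChartDomain i j M v) (hv : v < M) (h₀ : (γ t₀ : Pairs) = chart r i j M v) :
    HasDerivWithinAt (fun t => coords r i j (γ t)) (chartField (coords r i j (γ t₀)))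
      (Ici t₀) t₀ := by
  have hd := (coords r i j).hasFDerivAt.comp_hasDerivWithinAt t₀ (hγ.2 t₀ ht₀)
  rwa [coords_circulatingField h hv h₀, ← coords_chart r h.ne M v, ← h₀] at hd

theorem eventually_mem_chart (hγ : IsForwardSolution circulatingField T γ) (ht₀ : t₀ ∈ Ico 0 T)
    (h : ChartDomain i j M v) (hv : v < M) (h₀ : (γ t₀ : Pairs) = chart r i j M v) :
    ∀ᶠ t in 𝓝[≥] t₀, ∃ M' v', ChartDomain i j M' v' ∧ v' < M' ∧
      (γ t : Pairs) = chart r i j M' v' := by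
  rw [← Ioi_insert, nhdsWithin_insert, eventually_sup]
  refine ⟨eventually_pure.2 ⟨M, v, h, hv, h₀⟩, ?_⟩
  have hd := hγ.hasDerivWithinAt_coords ht₀ h hv h₀
  have hcoords : coords r i j (γ t₀) = (M, v) := by rw [h₀, coords_chart r h.ne]
  have hcont := hd.continuousWithinAt.mono Ioi_subset_Ici_self
  rw [hcoords] at hd
  have hM' : HasDerivWithinAt (fun t => (coords r i j (γ t)).1) (M * (1 - M)) (Ici t₀) t₀ := hd.fst
  have hv' : HasDerivWithinAt (fun t => (coords r i j (γ t)).2) M (Ici t₀) t₀ := hd.snd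
  have hne : ∀ᶠ t in 𝓝[>] t₀, (coords r i j (γ t)).2 ≠ 0 := by
    rw [← Ici_sdiff_left]
    exact hv'.eventually_ne h.pos.ne'
  have hneg : ∀ᶠ t in 𝓝[>] t₀, 0 < (coords r i j (γ t)).1 + (coords r i j (γ t)).2 := by
    filter_upwards [eventually_nhdsGT_lt_of_hasDerivWithinAt (hM'.add hv')
      (by nlinarith [h.pos, h.le_one])] with t ht
    simp only [Pi.add_apply, hcoords] at ht
    linarith [h.neg_le]
  have hlt : ∀ᶠ t in 𝓝[>] t₀, (coords r i j (γ t)).2 < (coords r i j (γ t)).1 :=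
    hcont.snd.eventually_lt hcont.fst (by simpa only [hcoords] using hv)
  filter_upwards [hne, hneg, hlt] with t hne hneg hlt
  have heq := eq_chart_of_coords h.ne (γ t).2 (Prod.mk.eta (p := coords r i j (γ t))).symm
    (by linarith) hne
  exact ⟨_, _, chartDomain_of_chart_mem_Config h.ne
    (_root_.abs_le.2 ⟨by linarith, hlt.le⟩) (heq ▸ (γ t).2), hlt, heq⟩

end IsForwardSolution

theorem lipschitzOnWith_chartField : LipschitzOnWith 1 chartField (Icc 0 1 ×ˢ univ) := by
  refine LipschitzOnWith.of_dist_le_mul fun p hp q hq => ?_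
  obtain ⟨⟨hp₀, hp₁⟩, -⟩ := hp
  obtain ⟨⟨hq₀, hq₁⟩, -⟩ := hq
  have hlogistic : |p.1 * (1 - p.1) - q.1 * (1 - q.1)| ≤ |p.1 - q.1| := by
    have hfactor : p.1 * (1 - p.1) - q.1 * (1 - q.1) = (p.1 - q.1) * (1 - p.1 - q.1) := by ring
    rw [hfactor, abs_mul]
    exact mul_le_of_le_one_right (abs_nonneg _) (abs_le.2 ⟨by linarith, by linarith⟩)
  rw [NNReal.coe_one, one_mul, Prod.dist_eq, Real.dist_eq, Real.dist_eq, Prod.dist_eq, Real.dist_eq]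
  exact max_le (hlogistic.trans (le_max_left _ _)) (le_max_left _ _)

namespace IsForwardSolution

variable {T : ℝ} {γ₁ γ₂ : ℝ → Config} {t₀ : ℝ} {r : Bool} {i j : Fin 3}

theorem eqOn_coords (h₁ : IsForwardSolution circulatingField T γ₁)
    (h₂ : IsForwardSolution circulatingField T γ₂) {b : ℝ} (hsub : Icc t₀ b ⊆ Ico 0 T)
    (hchart₁ : ∀ t ∈ Icc t₀ b, ∃ M v, ChartDomain i j M v ∧ v < M ∧
      (γ₁ t : Pairs) = chart r i j M v)
    (hchart₂ : ∀ t ∈ Icc t₀ b, ∃ M v, ChartDomain i j M v ∧ v < M ∧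
      (γ₂ t : Pairs) = chart r i j M v)
    (heq : γ₁ t₀ = γ₂ t₀) :
    EqOn (fun t => coords r i j (γ₁ t)) (fun t => coords r i j (γ₂ t)) (Icc t₀ b) := by
  have hcont : ∀ γ, IsForwardSolution circulatingField T γ →
      ContinuousOn (fun t => coords r i j (γ t)) (Icc t₀ b) := fun γ hγ =>
    ((coords r i j).continuous.comp continuous_subtype_val).comp_continuousOn (hγ.1.mono hsub)
  have hderiv : ∀ γ, IsForwardSolution circulatingField T γ → (∀ t ∈ Icc t₀ b, ∃ M v,
      ChartDomain i j M v ∧ v < M ∧ (γ t : Pairs) = chart r i j M v) → ∀ t ∈ Ico t₀ b,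
      HasDerivWithinAt (fun t => coords r i j (γ t)) (chartField (coords r i j (γ t)))
        (Ici t) t := fun γ hγ hc t ht => by
    obtain ⟨M, v, h, hv, hp⟩ := hc t (Ico_subset_Icc_self ht)
    exact hγ.hasDerivWithinAt_coords (hsub (Ico_subset_Icc_self ht)) h hv hp
  have hmem : ∀ γ : ℝ → Config, ∀ t ∈ Ico t₀ b,
      coords r i j (γ t) ∈ Icc (0 : ℝ) 1 ×ˢ (univ : Set ℝ) := fun γ t _ =>
    ⟨apply_mem_Icc_of_mem_graph ((swapIf_mem_Config r).2 (γ t).2).1 i, mem_univ _⟩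
  exact ODE_solution_unique_of_mem_Icc_right (fun _ _ => lipschitzOnWith_chartField)
    (hcont γ₁ h₁) (hderiv γ₁ h₁ hchart₁) (hmem γ₁) (hcont γ₂ h₂) (hderiv γ₂ h₂ hchart₂) (hmem γ₂)
    (by rw [heq])

theorem eventually_eq (h₁ : IsForwardSolution circulatingField T γ₁)
    (h₂ : IsForwardSolution circulatingField T γ₂) (ht₀ : t₀ ∈ Ico 0 T) (heq : γ₁ t₀ = γ₂ t₀) :
    ∀ᶠ t in 𝓝[≥] t₀, γ₁ t = γ₂ t := by
  obtain ⟨r, i, j, M, v, h, hv, hp⟩ := exists_chart (γ₁ t₀).2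
  obtain ⟨b, hb : t₀ < b, hbsub⟩ := mem_nhdsGE_iff_exists_Icc_subset.1
    ((h₁.eventually_mem_chart ht₀ h hv hp).and ((h₂.eventually_mem_chart ht₀ h hv
      (by rw [← heq, hp])).and (mem_nhdsWithin_of_mem_nhds (Iio_mem_nhds ht₀.2))))
  have hcoords := h₁.eqOn_coords h₂ (fun t ht => ⟨ht₀.1.trans ht.1, (hbsub ht).2.2⟩)
    (fun t ht => (hbsub ht).1) (fun t ht => (hbsub ht).2.1) heq
  filter_upwards [Icc_mem_nhdsGE hb] with t ht
  obtain ⟨M₁, v₁, hd, -, hp₁⟩ := (hbsub ht).1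
  obtain ⟨M₂, v₂, -, -, hp₂⟩ := (hbsub ht).2.1
  have hparam : (M₁, v₁) = (M₂, v₂) := by
    rw [← coords_chart r hd.ne, ← coords_chart r hd.ne M₂, ← hp₁, ← hp₂]
    exact hcoords ht
  exact Subtype.ext (by rw [hp₁, hp₂, (Prod.mk.inj hparam).1, (Prod.mk.inj hparam).2])

theorem eqOn (h₁ : IsForwardSolution circulatingField T γ₁)
    (h₂ : IsForwardSolution circulatingField T γ₂) (h₀ : γ₁ 0 = γ₂ 0) :
    EqOn γ₁ γ₂ (Ico 0 T) := by
  intro t ht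
  have hsub : Icc 0 t ⊆ Ico 0 T := fun s hs => ⟨hs.1, hs.2.trans_lt ht.2⟩
  have hclosed : IsClosed ({s | γ₁ s = γ₂ s} ∩ Icc 0 t) := by
    rw [inter_comm]
    exact ((h₁.1.mono hsub).prodMk (h₂.1.mono hsub)).preimage_isClosed_of_isClosed isClosed_Icc
      isClosed_diagonal
  refine hclosed.Icc_subset_of_forall_mem_nhdsWithin h₀ (fun s hs => ?_) (right_mem_Icc.2 ht.1)
  exact nhdsWithin_mono _ Ioi_subset_Ici_self
    (h₁.eventually_eq h₂ (hsub (Ico_subset_Icc_self hs.2)) hs.1)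

end IsForwardSolution

/-! ### Semiflows from local semiflows -/

section LocalFlow

variable {α : Type*} {δ : ℝ≥0} {σ : ℝ≥0 → α → α}

theorem iterate_div_eq (hzero : σ 0 = id) (hadd : ∀ s t, s + t < δ → σ (s + t) = σ s ∘ σ t)
    {t : ℝ≥0} (ht : t < δ) {n : ℕ} (hn : n ≠ 0) : (σ (t / n))^[n] = σ t := by
  have hn' : (n : ℝ≥0) ≠ 0 := Nat.cast_ne_zero.2 hn
  have hiterate : ∀ k ≤ n, (σ (t / n))^[k] = σ (k * (t / n)) := fun k hk => by
    induction k with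
    | zero => rw [Function.iterate_zero, Nat.cast_zero, zero_mul, hzero]
    | succ k ih =>
      have hle : k * (t / n) + t / n ≤ t :=
        calc k * (t / n) + t / n = (k + 1 : ℕ) * (t / n) := by push_cast; ring
          _ ≤ n * (t / n) := by gcongr
          _ = t := mul_div_cancel₀ t hn'
      rw [Function.iterate_succ, ih (Nat.le_of_succ_le hk), ← hadd _ _ (hle.trans_lt ht)]
      push_cast
      ring_nf
  rw [hiterate n le_rfl, mul_div_cancel₀ t hn']

theorem iterate_div_eq_iterate_div (hzero : σ 0 = id)
    (hadd : ∀ s t, s + t < δ → σ (s + t) = σ s ∘ σ t) {t : ℝ≥0} {m n : ℕ} (hm : m ≠ 0)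
    (hn : n ≠ 0) (hmt : t / m < δ) (hnt : t / n < δ) :
    (σ (t / m))^[m] = (σ (t / n))^[n] := by
  have hrefine : ∀ {m n : ℕ}, n ≠ 0 → t / m < δ →
      (σ (t / m))^[m] = (σ (t / (m * n)))^[m * n] := fun {m n} hn hmt => by
    rw [← iterate_div_eq hzero hadd hmt hn, div_div, ← Function.iterate_mul, mul_comm m]
  rw [hrefine hn hmt, hrefine hm hnt, mul_comm (m : ℝ≥0), mul_comm m]

theorem continuous_iterate_of_continuous {β : Type*} [TopologicalSpace α] [TopologicalSpace β]
    {f : β → α → α} (hf : Continuous fun q : β × α => f q.1 q.2) (n : ℕ) :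
    Continuous fun q : β × α => (f q.1)^[n] q.2 := by
  induction n with
  | zero => exact continuous_snd
  | succ n ih => exact ih.comp (continuous_fst.prodMk hf)

theorem continuousOn_iterate_div [TopologicalSpace α]
    (hcont : Continuous fun q : Iio δ × α => σ q.1 q.2) (n : ℕ) :
    ContinuousOn (fun q : ℝ≥0 × α => (σ (q.1 / n))^[n] q.2) {q | q.1 / n < δ} := by
  rw [continuousOn_iff_continuous_domRestrict]
  exact (continuous_iterate_of_continuous (f := fun t : Iio δ => σ t) hcont n).comp
    (f := fun q : {q : ℝ≥0 × α | q.1 / n < δ} => ((⟨q.1.1 / n, q.2⟩ : Iio δ), q.1.2))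
    (by fun_prop)

theorem exists_flow_of_local [TopologicalSpace α] (hδ : 0 < δ) (hzero : σ 0 = id)
    (hadd : ∀ s t, s + t < δ → σ (s + t) = σ s ∘ σ t)
    (hcont : Continuous fun q : Iio δ × α => σ q.1 q.2) :
    ∃ φ : Flow ℝ≥0 α, ∀ t < δ, ∀ p, φ t p = σ t p := by
  have hexists : ∀ t : ℝ≥0, ∃ n : ℕ, n ≠ 0 ∧ t / n < δ := fun t => by
    obtain ⟨n, hn⟩ := exists_nat_gt (t / δ)
    have hn₀ : (0 : ℝ≥0) < n := zero_le.trans_lt hn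
    exact ⟨n, by exact_mod_cast hn₀.ne', (div_lt_comm₀ hδ hn₀).1 hn⟩
  choose n hn₀ hn using hexists
  have hmap : ∀ {t : ℝ≥0} {m : ℕ}, m ≠ 0 → t / m < δ →
      (σ (t / n t))^[n t] = (σ (t / m))^[m] := fun {t m} hm₀ hm =>
    iterate_div_eq_iterate_div hzero hadd (hn₀ t) hm₀ (hn t) hm
  have hmap_of_lt : ∀ {t}, t < δ → (σ (t / n t))^[n t] = σ t := fun ht =>
    iterate_div_eq hzero hadd ht (hn₀ _)
  refine ⟨⟨fun t => (σ (t / n t))^[n t], ?_, fun s t p => ?_, fun p => ?_⟩,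
    fun t ht p => congrFun (hmap_of_lt ht) p⟩
  · refine continuous_iff_continuousAt.2 fun ⟨t, p⟩ => ?_
    have hnhds : {q : ℝ≥0 × α | q.1 / n t < δ} ∈ 𝓝 (t, p) :=
      (isOpen_lt (by fun_prop) continuous_const).mem_nhds (hn t)
    refine ((continuousOn_iterate_div hcont (n t)).continuousAt hnhds).congr ?_
    filter_upwards [hnhds] with q hq
    exact (congrFun (hmap (hn₀ t) hq) q.2).symm
  · set m := n (s + t)
    have hst : s / m + t / m < δ := by simpa only [add_div] using hn (s + t)
    have hcomm : Function.Commute (σ (s / m)) (σ (t / m)) := fun q => by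
      rw [← Function.comp_apply (f := σ (s / m)), ← hadd _ _ hst, add_comm,
        hadd _ _ (by rwa [add_comm]), Function.comp_apply]
    change (σ ((s + t) / m))^[m] p = _
    rw [hmap (hn₀ _) (le_self_add.trans_lt hst), hmap (hn₀ _) (le_add_self.trans_lt hst),
      ← Function.comp_apply (f := (σ (s / m))^[m]), ← hcomm.comp_iterate, add_div,
      hadd _ _ hst]
  · change (σ (0 / n 0))^[n 0] p = p
    rw [hmap_of_lt hδ, hzero, id]

end LocalFlow

/-! ### Existence of the semiflow -/

theorem hasDerivWithinAt_leg (i j : Fin 3) {ν : ℝ → ℝ} {ν' t : ℝ}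
    (hν : HasDerivWithinAt ν ν' (Ici t) t) (hmono : ∀ s ∈ Ici t, ν t ≤ ν s) :
    HasDerivWithinAt (fun s => leg i j (ν s))
      (if ν t < 0 then (-ν') • e j else ν' • e (i + 1)) (Ici t) t := by
  split_ifs with h
  · refine (hν.neg.smul_const (e j)).congr_of_eventuallyEq ?_ (leg_of_nonpos i j h.le)
    filter_upwards [hν.continuousWithinAt.eventually_lt_const h] with s hs
    exact leg_of_nonpos i j hs.le
  · rw [not_lt] at h
    exact (hν.smul_const (e (i + 1))).congr (fun s hs => leg_of_nonneg i j (h.trans (hmono s hs)))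
      (leg_of_nonneg i j h)

theorem hasDerivWithinAt_chart (r : Bool) (i j : Fin 3) {μ ν : ℝ → ℝ} {μ' ν' t : ℝ}
    (hμ : HasDerivWithinAt μ μ' (Ici t) t) (hν : HasDerivWithinAt ν ν' (Ici t) t)
    (hmono : ∀ s ∈ Ici t, ν t ≤ ν s) :
    HasDerivWithinAt (fun s => chart r i j (μ s) (ν s))
      (swapIf r (μ' • e i, if ν t < 0 then (-ν') • e j else ν' • e (i + 1))) (Ici t) t :=
  (swapIf r).hasFDerivAt.comp_hasDerivWithinAt t
    ((hμ.smul_const (e i)).prodMk (hasDerivWithinAt_leg i j hν hmono))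

theorem hasDerivWithinAt_run (r : Bool) {i j : Fin 3} {M v t : ℝ} (h : ChartDomain i j M v)
    (h₀ : 0 ≤ t) (ht : t < Real.log 3) {p : Config} (hp : (p : Pairs) = run r i j M v t) :
    HasDerivWithinAt (run r i j M v) (circulatingField p) (Ici t) t := by
  have hgrowth := (hasDerivAt_growth h.pos.le h₀).hasDerivWithinAt (s := Ici t)
  have htravel := (hasDerivAt_travel h.pos.le h₀).hasDerivWithinAt (s := Ici t)
  have hmono : ∀ s ∈ Ici t, travel M t ≤ travel M s := fun s hs => travel_mono h.pos.le h₀ hs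
  rcases lt_or_ge t (hit M v) with hlt | hge
  · rw [run_of_le hlt.le] at hp
    have hgap : v + travel M t < growth M t :=
      sub_neg.1 ((gap_neg_iff h.pos h.le h₀).2 hlt)
    rw [circulatingField_chart (h.before_hit h₀ hlt.le) hgap hp]
    refine (hasDerivWithinAt_chart r i j hgrowth (htravel.const_add v)
      fun s hs => by linarith [hmono s hs]).congr_of_eventuallyEq ?_ (run_of_le hlt.le)
    filter_upwards [mem_nhdsWithin_of_mem_nhds (Iio_mem_nhds hlt)] with s hs
    exact run_of_le (le_of_lt hs)
  · rw [run_of_ge h.pos h.le hge] at hp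
    have ht' : t < hit M v + Real.log 3 := by linarith [hit_nonneg M v]
    rw [circulatingField_chart (h.after_hit hge ht') (h.lt_growth_after_hit hge ht') hp]
    exact (hasDerivWithinAt_chart (!r) (i + 1) i hgrowth
      ((htravel.const_add v).sub_const (2 * growth M (hit M v)))
      fun s hs => by linarith [hmono s hs]).congr
      (fun s hs => run_of_ge h.pos h.le (hge.trans hs)) (run_of_ge h.pos h.le hge)

theorem exists_isForwardSolution_of_curve {X : Config → Pairs} {T : ℝ} (hT : 0 < T)
    {c : ℝ → Pairs} (hc : ContinuousOn c (Ico 0 T)) (hmem : MapsTo c (Ico 0 T) Config)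
    (hderiv : ∀ t ∈ Ico 0 T, ∀ p : Config, (p : Pairs) = c t →
      HasDerivWithinAt c (X p) (Ici t) t) :
    ∃ γ, IsForwardSolution X T γ ∧ ∀ t ∈ Ico 0 T, (γ t : Pairs) = c t := by
  classical
  let γ (t : ℝ) : Config :=
    if ht : t ∈ Ico 0 T then ⟨c t, hmem ht⟩ else ⟨c 0, hmem ⟨le_rfl, hT⟩⟩
  have hγ : ∀ t ∈ Ico 0 T, (γ t : Pairs) = c t := fun t ht => by simp only [γ, dif_pos ht]
  refine ⟨γ, ⟨?_, fun t ht => ?_⟩, hγ⟩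
  · exact Topology.IsInducing.subtypeVal.continuousOn_iff.2 (hc.congr hγ)
  · refine (hderiv t ht (γ t) (hγ t ht)).congr_of_eventuallyEq ?_ (hγ t ht)
    filter_upwards [Ico_mem_nhdsGE ht.2] with s hs
    exact hγ s ⟨ht.1.trans hs.1, hs.2⟩

theorem exists_isForwardSolution_run (r : Bool) {i j : Fin 3} {M v : ℝ}
    (h : ChartDomain i j M v) :
    ∃ γ, IsForwardSolution circulatingField (Real.log 3) γ ∧
      ∀ t ∈ Ico 0 (Real.log 3), (γ t : Pairs) = run r i j M v t := by
  refine exists_isForwardSolution_of_curve (zero_lt_one.trans one_lt_log_three) ?_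
    (fun t ht => run_mem_Config r h ht.1 ht.2)
    (fun t ht p hp => hasDerivWithinAt_run r h ht.1 ht.2 hp)
  rw [continuousOn_iff_continuous_domRestrict]
  exact continuous_run r i j continuous_const continuous_const continuous_subtype_val
    (fun _ => h.pos) (fun _ => h.le) fun t => t.2.1

theorem IsForwardSolution.eq_run {γ : ℝ → Config} {T : ℝ}
    (hγ : IsForwardSolution circulatingField T γ) {r : Bool} {i j : Fin 3} {M v : ℝ}
    (h : ChartDomain i j M v) (h₀ : (γ 0 : Pairs) = chart r i j M v) {t : ℝ} (ht : t ∈ Ico 0 T)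
    (ht' : t < Real.log 3) : (γ t : Pairs) = run r i j M v t := by
  obtain ⟨γ', hγ', hrun⟩ := exists_isForwardSolution_run r h
  have hpos : (0 : ℝ) < Real.log 3 := zero_lt_one.trans one_lt_log_three
  rw [← hrun t ⟨ht.1, ht'⟩, (hγ.mono (min_le_left T (Real.log 3))).eqOn
    (hγ'.mono (min_le_right T (Real.log 3))) ?_ ⟨ht.1, lt_min ht.2 ht'⟩]
  exact Subtype.ext (by rw [h₀, hrun 0 ⟨le_rfl, hpos⟩, run_zero])

theorem comp_eq_add_of_isForwardSolution {X : Config → Pairs}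
    (hunique : ∀ T γ₁ γ₂, IsForwardSolution X T γ₁ → IsForwardSolution X T γ₂ → γ₁ 0 = γ₂ 0 →
      EqOn γ₁ γ₂ (Ico 0 T))
    {δ : ℝ≥0} {σ : ℝ≥0 → Config → Config} (hzero : σ 0 = id)
    (hσ : ∀ p, IsForwardSolution X δ fun t => σ t.toNNReal p) {s t : ℝ≥0} (hst : s + t < δ) :
    σ (s + t) = σ s ∘ σ t := by
  ext1 p
  have heq := hunique (δ - t) _ _ ((hσ p).shift t.2) ((hσ (σ t p)).mono (by simp))
    (by simp [hzero]) ⟨s.2, lt_sub_iff_add_lt.2 hst⟩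
  simpa only [← NNReal.coe_add, NNReal.val_eq_coe, Real.toNNReal_coe, Function.comp_apply]
    using heq

theorem exists_generates_of_local {X : Config → Pairs}
    (hunique : ∀ T γ₁ γ₂, IsForwardSolution X T γ₁ → IsForwardSolution X T γ₂ → γ₁ 0 = γ₂ 0 →
      EqOn γ₁ γ₂ (Ico 0 T))
    {δ : ℝ≥0} (hδ : 0 < δ) {σ : ℝ≥0 → Config → Config} (hzero : σ 0 = id)
    (hσ : ∀ p, IsForwardSolution X δ fun t => σ t.toNNReal p)
    (hcont : Continuous fun q : Iio δ × Config => σ q.1 q.2) :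
    ∃ φ : Flow ℝ≥0 Config, Generates X φ := by
  obtain ⟨φ, hφ⟩ := exists_flow_of_local hδ hzero
    (fun s t => comp_eq_add_of_isForwardSolution hunique hzero hσ) hcont
  have hsol : ∀ p T, IsForwardSolution X T fun t => φ t.toNNReal p := fun p T => by
    refine ⟨Continuous.continuousOn (by fun_prop), fun t ht => ?_⟩
    have hderiv : HasDerivWithinAt (fun s : ℝ => (σ (s + -t).toNNReal (φ t.toNNReal p) : Pairs))
        (X (φ t.toNNReal p)) (Ici t) t := by
      refine hasDerivWithinAt_comp_add_const
        (f := fun s : ℝ => (σ s.toNNReal (φ t.toNNReal p) : Pairs)) ?_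
      simpa [hzero] using (hσ (φ t.toNNReal p)).2 0 ⟨le_rfl, by exact_mod_cast hδ⟩
    refine hderiv.congr_of_eventuallyEq ?_ (by simp [hzero])
    filter_upwards [Ico_mem_nhdsGE (lt_add_of_pos_right t (NNReal.coe_pos.2 hδ))] with s hs
    rw [← hφ _ (Real.toNNReal_lt_iff_lt_coe (by linarith [hs.1]) |>.2 (by linarith [hs.2])),
      ← φ.map_add, ← Real.toNNReal_add (by linarith [hs.1]) ht.1, neg_add_cancel_right]
  refine ⟨φ, hsol, fun T γ hγ t ht => hunique T _ _ hγ (hsol (γ 0) T) ?_ ht⟩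
  rw [Real.toNNReal_zero, φ.map_zero_apply]

/-- The configurations in the chart with the given labels. -/
def chartSet (k : Bool × Fin 3 × Fin 3) : Set Config :=
  {p | ∃ M v, ChartDomain k.2.1 k.2.2 M v ∧ (p : Pairs) = chart k.1 k.2.1 k.2.2 M v}

theorem mem_chartSet_iff {r : Bool} {i j : Fin 3} {p : Config} :
    p ∈ chartSet (r, i, j) ↔ j ≠ i + 1 ∧ |(coords r i j p).2| ≤ (coords r i j p).1 ∧
      (p : Pairs) = chart r i j (coords r i j p).1 (coords r i j p).2 := by
  refine ⟨fun ⟨M, v, h, hp⟩ => ?_, fun ⟨hj, hle, hp⟩ => ?_⟩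
  · rw [hp, coords_chart r h.ne]
    exact ⟨h.ne, h.abs_le, rfl⟩
  · exact ⟨_, _, chartDomain_of_chart_mem_Config hj hle (hp ▸ p.2), hp⟩

theorem isClosed_chartSet (k : Bool × Fin 3 × Fin 3) : IsClosed (chartSet k) := by
  obtain ⟨r, i, j⟩ := k
  have hcoords : Continuous fun p : Config => coords r i j p :=
    (coords r i j).continuous.comp continuous_subtype_val
  have hset : chartSet (r, i, j) = {p : Config | j ≠ i + 1 ∧
      |(coords r i j p).2| ≤ (coords r i j p).1 ∧
      (p : Pairs) = chart r i j (coords r i j p).1 (coords r i j p).2} := ext fun p =>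
    mem_chartSet_iff
  rw [hset]
  exact isClosed_const.and ((isClosed_le hcoords.snd.abs hcoords.fst).and
    (isClosed_eq continuous_subtype_val ((continuous_chart r i j).comp hcoords)))

theorem iUnion_chartSet : ⋃ k, chartSet k = univ :=
  eq_univ_of_forall fun p =>
    let ⟨r, i, j, M, v, h, _, hp⟩ := exists_chart p.2
    mem_iUnion.2 ⟨(r, i, j), M, v, h, hp⟩

theorem continuous_of_eq_run {Y : Type*} [TopologicalSpace Y] {f p : Y → Config} {t : Y → ℝ≥0}
    (hp : Continuous p) (ht : Continuous t)
    (hf : ∀ y r i j M v, ChartDomain i j M v → (p y : Pairs) = chart r i j M v →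
      (f y : Pairs) = run r i j M v (t y)) : Continuous f := by
  refine (locallyFinite_of_finite fun k => p ⁻¹' chartSet k).continuous ?_
    (fun k => (isClosed_chartSet k).preimage hp) fun ⟨r, i, j⟩ => ?_
  · rw [← preimage_iUnion, iUnion_chartSet, preimage_univ]
  rw [Topology.IsInducing.subtypeVal.continuousOn_iff, continuousOn_iff_continuous_domRestrict]
  have hcoords : Continuous fun y : p ⁻¹' chartSet (r, i, j) => coords r i j (p y) := by fun_prop
  have hchart (y : p ⁻¹' chartSet (r, i, j)) :
      ChartDomain i j (coords r i j (p y)).1 (coords r i j (p y)).2 ∧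
        (p y : Pairs) = chart r i j (coords r i j (p y)).1 (coords r i j (p y)).2 := by
    obtain ⟨M, v, h, hy⟩ := y.2
    rw [hy, coords_chart r h.ne]
    exact ⟨h, rfl⟩
  exact (continuous_run r i j hcoords.fst hcoords.snd
    (t := fun y : p ⁻¹' chartSet (r, i, j) => (t y : ℝ)) (by fun_prop) (fun y => (hchart y).1.pos)
    (fun y => (hchart y).1.le) fun y => (t y).2).congr fun y =>
    (hf y r i j _ _ (hchart y).1 (hchart y).2).symm

theorem exists_generates_circulatingField :
    ∃ φ : Flow ℝ≥0 Config, Generates circulatingField φ := by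
  have hsol : ∀ p : Config, ∃ γ, IsForwardSolution circulatingField 1 γ ∧ γ 0 = p := fun p => by
    obtain ⟨r, i, j, M, v, h, -, hp⟩ := exists_chart p.2
    obtain ⟨γ, hγ, hrun⟩ := exists_isForwardSolution_run r h
    refine ⟨γ, hγ.mono one_lt_log_three.le, Subtype.ext ?_⟩
    rw [hp, hrun 0 ⟨le_rfl, zero_lt_one.trans one_lt_log_three⟩, run_zero]
  choose γ hγ hγ₀ using hsol
  refine exists_generates_of_local (fun T γ₁ γ₂ => IsForwardSolution.eqOn) zero_lt_one
    (σ := fun t p => γ p t) (funext hγ₀) (fun p => ?_) ?_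
  · exact (hγ p).congr fun t ht => by simp only [Real.coe_toNNReal t ht.1]
  · refine continuous_of_eq_run continuous_snd (continuous_subtype_val.comp continuous_fst)
      fun q r i j M v h hq => ?_
    have hlt : ((q.1 : ℝ≥0) : ℝ) < 1 := q.1.2
    exact (hγ q.2).eq_run h (by rw [hγ₀, hq]) ⟨NNReal.coe_nonneg _, hlt⟩
      (hlt.trans one_lt_log_three)

namespace Generates

variable {φ : Flow ℝ≥0 Config}

theorem eq_run (hφ : Generates circulatingField φ) {r : Bool} {i j : Fin 3} {M v : ℝ}
    (h : ChartDomain i j M v) {p : Config} (hp : (p : Pairs) = chart r i j M v) {t : ℝ≥0}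
    (ht : t < Real.log 3) : (φ t p : Pairs) = run r i j M v t := by
  simpa only [Real.toNNReal_coe] using (hφ.1 p (Real.log 3)).eq_run h
    (by rwa [Real.toNNReal_zero, φ.map_zero_apply]) ⟨t.coe_nonneg, ht⟩ ht

end Generates

/-! ### Periodic orbits of semiflows -/

theorem forall_of_forall_le_of_add {δ : ℝ≥0} (hδ : 0 < δ) {P : ℝ≥0 → Prop}
    (hsmall : ∀ t ≤ δ, P t) (hadd : ∀ s t, P s → P t → P (s + t)) (t : ℝ≥0) : P t := by
  obtain ⟨n, hn⟩ := exists_nat_ge (t / δ)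
  rw [div_le_iff₀ hδ] at hn
  induction n generalizing t with
  | zero => exact hsmall t (hn.trans (by simp))
  | succ n ih =>
    rcases le_total t δ with h | h
    · exact hsmall t h
    · rw [← tsub_add_cancel_of_le h]
      refine hadd _ _ (ih _ (tsub_le_iff_right.2 ?_)) (hsmall δ le_rfl)
      rwa [Nat.cast_succ, add_one_mul] at hn

section PeriodicOrbit

variable {α : Type*} [TopologicalSpace α] {φ : Flow ℝ≥0 α} {Γ Γ' : Set α} {p : α} {T : ℝ≥0}

theorem flow_nat_mul_eq_self (hp : φ T p = p) (n : ℕ) : φ (n * T) p = p := by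
  induction n with
  | zero => rw [Nat.cast_zero, zero_mul, φ.map_zero_apply]
  | succ n ih => rw [Nat.cast_succ, add_one_mul, φ.map_add, hp, ih]

theorem mem_omegaLimit_of_flow_eq_self (hT : 0 < T) (hp : φ T p = p) :
    p ∈ omegaLimit atTop φ {p} := by
  rw [mem_omegaLimit_singleton_iff_mapClusterPt]
  have hlim : Tendsto (fun n : ℕ => (n : ℝ≥0) * T) atTop atTop :=
    tendsto_natCast_atTop_atTop.atTop_mul_const hT
  refine MapClusterPt.of_comp hlim (Tendsto.mapClusterPt ?_)
  exact tendsto_const_nhds.congr fun n => (flow_nat_mul_eq_self hp n).symm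

theorem exists_nhdsSet_forall_le_flow_mem (hΓ : IsCompact Γ) (hinv : ∀ t, MapsTo (φ t) Γ Γ)
    {V : Set α} (hV : V ∈ 𝓝ˢ Γ) (T : ℝ≥0) : ∃ W ∈ 𝓝ˢ Γ, ∀ p ∈ W, ∀ t ≤ T, φ t p ∈ V := by
  have hopen : IsOpen {q : ℝ≥0 × α | φ q.1 q.2 ∈ interior V} :=
    isOpen_interior.preimage φ.cont'
  obtain ⟨u, w, -, hw, hu, hΓw, huw⟩ := generalized_tube_lemma
    (isCompact_Icc (a := (0 : ℝ≥0)) (b := T)) hΓ hopen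
    fun q hq => subset_interior_iff_mem_nhdsSet.2 hV (hinv q.1 hq.2)
  exact ⟨w, hw.mem_nhdsSet.2 hΓw, fun p hp t ht =>
    interior_subset (huw (show (t, p) ∈ u ×ˢ w from ⟨hu ⟨zero_le, ht⟩, hp⟩))⟩

namespace IsPeriodicOrbit

theorem range_eq (h : IsPeriodicOrbit φ Γ) (hp : p ∈ Γ) : range (fun t => φ t p) = Γ := by
  obtain ⟨p₀, ⟨T, hT, hp₀⟩, -, rfl⟩ := h
  obtain ⟨s, rfl⟩ := hp
  apply Subset.antisymm
  · rintro _ ⟨t, rfl⟩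
    exact ⟨t + s, φ.map_add t s p₀⟩
  · rintro _ ⟨t, rfl⟩
    obtain ⟨n, hn⟩ := exists_nat_ge (s / T)
    refine ⟨t + (n * T - s), ?_⟩
    simp only [← φ.map_add]
    rw [add_assoc, tsub_add_cancel_of_le ((div_le_iff₀ hT).1 hn), φ.map_add,
      flow_nat_mul_eq_self hp₀]

theorem mapsTo (h : IsPeriodicOrbit φ Γ) (t : ℝ≥0) : MapsTo (φ t) Γ Γ := fun _ hp =>
  h.range_eq hp ▸ mem_range_self t

theorem isCompact (h : IsPeriodicOrbit φ Γ) : IsCompact Γ := by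
  obtain ⟨p₀, ⟨T, hT, hp₀⟩, -, rfl⟩ := h
  have himage : range (fun t => φ t p₀) = (fun t => φ t p₀) '' Icc 0 T := by
    refine Subset.antisymm ?_ (image_subset_range _ _)
    rintro _ ⟨t, rfl⟩
    have hle : ⌊t / T⌋₊ * T ≤ t := (le_div_iff₀ hT).1 (Nat.floor_le zero_le)
    have hlt : t < (⌊t / T⌋₊ + 1) * T := (div_lt_iff₀ hT).1 (Nat.lt_floor_add_one _)
    refine ⟨t - ⌊t / T⌋₊ * T, ⟨zero_le, tsub_le_iff_left.2 ?_⟩, ?_⟩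
    · rw [← add_one_mul]
      exact hlt.le
    · change φ _ p₀ = φ t p₀
      conv_rhs => rw [← tsub_add_cancel_of_le hle, φ.map_add, flow_nat_mul_eq_self hp₀]
  rw [himage]
  exact isCompact_Icc.image (by fun_prop)

theorem approaches_of_tendsto [T2Space α] (h : IsPeriodicOrbit φ Γ)
    (hlim : Tendsto (fun t => φ t p) atTop (𝓝ˢ Γ)) : Approaches φ p Γ := by
  have hsub : omegaLimit atTop φ {p} ⊆ Γ := fun q hq => by
    rw [mem_omegaLimit_singleton_iff_mapClusterPt] at hq
    by_contra hqΓ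
    have hdisj : Disjoint (𝓝ˢ Γ) (𝓝 q) := h.isCompact.disjoint_nhdsSet_left.2 fun x hx =>
      disjoint_nhds_nhds.2 fun hxq => hqΓ (hxq ▸ hx)
    exact NeBot.ne hq (hdisj.mono_left hlim).symm.eq_bot
  obtain ⟨q, hq⟩ : (omegaLimit atTop φ {p}).Nonempty := by
    by_contra hempty
    have hdisj : Disjoint (𝓝ˢ Γ) (map (fun t => φ t p) atTop) :=
      h.isCompact.disjoint_nhdsSet_left.2 fun x _ => by
        by_contra hx
        exact hempty ⟨x, (mem_omegaLimit_singleton_iff_mapClusterPt _ _ _ _).2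
          (neBot_iff.2 (disjoint_iff.not.1 hx))⟩
    exact (map_neBot (f := atTop)).ne (disjoint_self.1 (hdisj.mono_left hlim))
  refine ⟨hlim, hsub.antisymm ?_⟩
  rw [← h.range_eq (hsub hq)]
  rintro _ ⟨t, rfl⟩
  exact φ.isInvariant_omegaLimit atTop {p}
    (fun t => tendsto_atTop_mono (fun s => le_add_self) tendsto_id) t hq

theorem eq_of_approaches (h : IsPeriodicOrbit φ Γ) (h' : IsPeriodicOrbit φ Γ')
    (happ : ∀ p ∈ Γ', Approaches φ p Γ) : Γ' = Γ := by
  obtain ⟨p, ⟨T, hT, hp⟩, -, rfl⟩ := h'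
  refine h.range_eq ?_
  rw [← (happ p ⟨T, hp⟩).2]
  exact mem_omegaLimit_of_flow_eq_self hT hp

end IsPeriodicOrbit

end PeriodicOrbit

theorem mem_posTangentConeAt_of_hasDerivWithinAt {E : Type*} [NormedAddCommGroup E]
    [NormedSpace ℝ E] {γ : ℝ → E} {S : Set E} {y : E} {t : ℝ}
    (hγ : HasDerivWithinAt γ y (Ici t) t) (hS : ∀ᶠ s in 𝓝[>] t, γ s ∈ S) :
    y ∈ posTangentConeAt S (γ t) := by
  have hcont := hγ.continuousWithinAt.tendsto.mono_left (nhdsWithin_mono t Ioi_subset_Ici_self)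
  have hslope := hasDerivWithinAt_iff_tendsto_slope.1 hγ
  rw [Ici_sdiff_left] at hslope
  refine mem_tangentConeAt_of_seq (𝓝[>] t) (fun s => (s - t)⁻¹.toNNReal) (fun s => γ s - γ t)
    (by simpa using hcont.sub_const (γ t)) (by simpa using hS) (hslope.congr' ?_)
  filter_upwards [self_mem_nhdsWithin] with s hs
  rw [slope_def_module, NNReal.smul_def, Real.coe_toNNReal _ (inv_nonneg.2 (sub_pos.2 hs).le)]

namespace Generates

variable {X : Config → Pairs} {φ : Flow ℝ≥0 Config}

theorem hasDerivWithinAt_zero (hφ : Generates X φ) (p : Config) :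
    HasDerivWithinAt (fun s : ℝ => (φ s.toNNReal p : Pairs)) (X p) (Ici 0) 0 := by
  simpa using (hφ.1 p 1).2 0 ⟨le_rfl, one_pos⟩

theorem mem_posTangentConeAt (hφ : Generates X φ) (p : Config) :
    X p ∈ posTangentConeAt Config (p : Pairs) := by
  simpa using mem_posTangentConeAt_of_hasDerivWithinAt (hφ.hasDerivWithinAt_zero p)
    (Eventually.of_forall fun s => (φ s.toNNReal p).2)

theorem exists_flow_ne (hφ : Generates X φ) {p : Config} (hp : X p ≠ 0) : ∃ t, φ t p ≠ p := by
  by_contra! hconst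
  have hderiv := hφ.hasDerivWithinAt_zero p
  simp only [hconst] at hderiv
  exact hp ((uniqueDiffWithinAt_Ici 0).eq_deriv _ hderiv (hasDerivWithinAt_const _ _ _))

end Generates

/-! ### The punctured disc and the norm along the orbits -/

theorem forall_smul_e_mul_smul_e_eq_zero_iff {a b : ℝ} (ha : a ≠ 0) (hb : b ≠ 0) {i j : Fin 3} :
    (∀ k, (a • e i) k * (b • e j) k = 0) ↔ i ≠ j := by
  simp only [smul_e_apply]
  refine ⟨fun h hij => ?_, fun hij k => by grind⟩
  simpa [hij, ha, hb] using h j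

theorem mem_disc_iff {p : Config} : p ∈ disc ↔ ∀ k, p.1.1 k * p.1.2 k = 0 := by
  obtain ⟨⟨x, y⟩, ⟨i, a, ⟨ha₀, -⟩, hx⟩, ⟨j, b, ⟨hb₀, -⟩, hy⟩, hne⟩ := p
  simp only at hx hy hne
  subst hx hy
  change index (a • e i) ≠ index (b • e j) ↔ ∀ k, (a • e i) k * (b • e j) k = 0
  rcases ha₀.eq_or_lt with rfl | ha <;> rcases hb₀.eq_or_lt with rfl | hb
  · exact absurd (by simp) hne
  · simp [index_smul_e hb, index_zero]
  · simp [index_smul_e ha, index_zero]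
  · rw [index_smul_e ha, index_smul_e hb, forall_smul_e_mul_smul_e_eq_zero_iff ha.ne' hb.ne',
      Ne, Option.some.injEq]

theorem mem_disc_iff_of_eq_chart {r : Bool} {i j : Fin 3} {M v : ℝ} (hM : 0 < M) {p : Config}
    (hp : (p : Pairs) = chart r i j M v) : p ∈ disc ↔ 0 ≤ v ∨ j ≠ i := by
  have hprod : p ∈ disc ↔ ∀ k, (M • e i) k * leg i j v k = 0 := by
    rw [mem_disc_iff, hp]
    cases r
    · rfl
    · simp only [chart, swapIf_true, Prod.swap_prod_mk, mul_comm]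
  rw [hprod]
  have hi := ne_add_one i
  rcases le_or_gt 0 v with hv | hv
  · simp only [leg_of_nonneg i j hv, smul_e_apply]
    grind
  · rw [leg_of_nonpos i j hv.le, forall_smul_e_mul_smul_e_eq_zero_iff hM.ne' (neg_pos.2 hv).ne',
      or_iff_right hv.not_ge, ne_comm]

theorem mem_discBoundary_iff {p : Config} : p ∈ discBoundary ↔ p ∈ disc ∧ ‖(p : Pairs)‖ = 1 := by
  have hp := (norm_mem_Ioc_of_mem_Config p.2).2
  have hfst : ‖p.1.1‖ ≤ ‖(p : Pairs)‖ := norm_fst_le _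
  have hsnd : ‖p.1.2‖ ≤ ‖(p : Pairs)‖ := norm_snd_le _
  refine and_congr_right fun _ => ⟨?_, fun h => ?_⟩
  · rintro (h | h) <;> linarith
  · rw [Prod.norm_def] at h
    exact (max_choice ‖p.1.1‖ ‖p.1.2‖).imp (fun h' => h'.symm.trans h) fun h' => h'.symm.trans h

namespace Generates

variable {φ : Flow ℝ≥0 Config}

theorem norm_flow (hφ : Generates circulatingField φ) (p : Config) (t : ℝ≥0) :
    ‖(φ t p : Pairs)‖ = growth ‖(p : Pairs)‖ t := by
  refine forall_of_forall_le_of_add one_pos (P := fun t => ∀ p : Config,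
    ‖(φ t p : Pairs)‖ = growth ‖(p : Pairs)‖ t) (fun t ht p => ?_) (fun s t hs ht p => ?_) t p
  · obtain ⟨r, i, j, M, v, h, -, hp⟩ := exists_chart p.2
    have ht' : (t : ℝ) < Real.log 3 := one_lt_log_three.trans_le' ht
    rw [hφ.eq_run h hp ht', norm_run r h t.coe_nonneg ht', hp, norm_chart r i j h.abs_le]
  · rw [φ.map_add, hs, ht, growth_add (norm_mem_Ioc_of_mem_Config p.2).1 t.coe_nonneg
      s.coe_nonneg, NNReal.coe_add, add_comm (t : ℝ)]

theorem flow_mem_disc_of_lt_log_three (hφ : Generates circulatingField φ) {p : Config} {t : ℝ≥0}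
    (ht : t < Real.log 3) (hp : p ∈ disc ∨ 1 ≤ t) : φ t p ∈ disc := by
  obtain ⟨r, i, j, M, v, h, -, hpc⟩ := exists_chart p.2
  have hrun := hφ.eq_run h hpc ht
  rcases le_total (t : ℝ) (hit M v) with hle | hge
  · rw [run_of_le hle] at hrun
    rw [mem_disc_iff_of_eq_chart (h.before_hit t.coe_nonneg hle).pos hrun]
    rcases hp with hp | ht₁
    · exact ((mem_disc_iff_of_eq_chart h.pos hpc).1 hp).imp_left fun hv =>
        add_nonneg hv (travel_nonneg h.pos.le t.coe_nonneg)
    · have htravel : travel M 1 ≤ travel M t := travel_mono h.pos.le zero_le_one ht₁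
      left
      linarith [h.neg_le, le_travel_one h.pos.le h.le_one]
  · rw [run_of_ge h.pos h.le hge] at hrun
    have hafter := h.after_hit hge (by linarith [hit_nonneg M v])
    exact (mem_disc_iff_of_eq_chart hafter.pos hrun).2 (Or.inr (ne_add_one i))

theorem flow_mem_disc (hφ : Generates circulatingField φ) {p : Config} (hp : p ∈ disc)
    (t : ℝ≥0) : φ t p ∈ disc :=
  forall_of_forall_le_of_add one_pos (P := fun t => ∀ p ∈ disc, φ t p ∈ disc)
    (fun _ ht _ hp => hφ.flow_mem_disc_of_lt_log_three (one_lt_log_three.trans_le' ht) (Or.inl hp))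
    (fun s t hs ht p hp => φ.map_add s t p ▸ hs _ (ht p hp)) t p hp

theorem flow_mem_disc_of_one_le (hφ : Generates circulatingField φ) (p : Config) {t : ℝ≥0}
    (ht : 1 ≤ t) : φ t p ∈ disc := by
  rw [← tsub_add_cancel_of_le ht, φ.map_add]
  exact hφ.flow_mem_disc (hφ.flow_mem_disc_of_lt_log_three
    (by simpa using one_lt_log_three) (Or.inr le_rfl)) _

theorem flow_mem_discBoundary (hφ : Generates circulatingField φ) {p : Config}
    (hp : p ∈ discBoundary) (t : ℝ≥0) : φ t p ∈ discBoundary := by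
  rw [mem_discBoundary_iff] at hp ⊢
  exact ⟨hφ.flow_mem_disc hp.1 t, by rw [hφ.norm_flow, hp.2, growth_one]⟩

end Generates

/-! ### The limit cycle -/

theorem chartDomain_rim (i : Fin 3) {v : ℝ} (hv : v ∈ Icc (-1 : ℝ) 1) :
    ChartDomain i (i + 2) 1 v where
  pos := one_pos
  le_one := le_rfl
  neg_le := hv.1
  le := hv.2
  ne := by decide +revert
  neg_lt h := absurd h (by decide +revert)

/-- The side of the boundary of the disc on which the leading point is at the end of the edge `i`
and the following point moves from the edge `i + 2` to the edge `i + 1`. -/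
def rim (r : Bool) (i : Fin 3) (v : Icc (-1 : ℝ) 1) : Config :=
  ⟨chart r i (i + 2) 1 v, chart_mem_Config r (chartDomain_rim i v.2)⟩

theorem rim_mem_discBoundary (r : Bool) (i : Fin 3) (v : Icc (-1 : ℝ) 1) :
    rim r i v ∈ discBoundary := by
  rw [mem_discBoundary_iff, mem_disc_iff_of_eq_chart one_pos rfl]
  exact ⟨Or.inr (by decide +revert), norm_chart r i (i + 2) (chartDomain_rim i v.2).abs_le⟩

theorem exists_eq_rim {p : Config} (hp : p ∈ discBoundary) : ∃ r i v, p = rim r i v := by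
  rw [mem_discBoundary_iff] at hp
  obtain ⟨r, i, j, M, v, h, -, hpc⟩ := exists_chart p.2
  obtain rfl : M = 1 := by rw [← hp.2, hpc, norm_chart r i j h.abs_le]
  refine ⟨r, i, ⟨v, h.neg_le, h.le⟩, Subtype.ext (hpc.trans ?_)⟩
  rcases (mem_disc_iff_of_eq_chart one_pos hpc).1 hp.1 with hv | hj
  · exact (chart_of_nonneg r i j 1 hv).trans (chart_of_nonneg r i (i + 2) 1 hv).symm
  · change chart r i j 1 v = chart r i (i + 2) 1 v
    rw [eq_add_two_of_ne hj h.ne]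

/-- The corners of the boundary of the disc, at which the roles of the two points are exchanged. -/
def node (a : Bool × Fin 3) : Config := rim a.1 a.2 ⟨-1, by simp⟩

/-- The order in which the limit cycle runs through the corners. -/
def nextNode (a : Bool × Fin 3) : Bool × Fin 3 := (!a.1, a.2 + 1)

theorem rim_one (r : Bool) (i : Fin 3) : rim r i ⟨1, by simp⟩ = node (nextNode (r, i)) := by
  apply Subtype.ext
  change chart r i (i + 2) 1 1 = chart (!r) (i + 1) (i + 1 + 2) 1 (-1)
  have hi : i + 1 + 2 = i := by decide +revert
  rw [chart_tie r i _ zero_le_one, hi]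

theorem exists_nextNode_iterate_eq (a b : Bool × Fin 3) : ∃ n : ℕ, nextNode^[n] a = b := by
  have hfin : ∀ a b : Bool × Fin 3, ∃ k : Fin 6, nextNode^[k] a = b := by
    unfold nextNode
    decide
  obtain ⟨k, hk⟩ := hfin a b
  exact ⟨k, hk⟩

theorem nextNode_iterate_six (a : Bool × Fin 3) : nextNode^[6] a = a := by
  unfold nextNode
  decide +revert

namespace Generates

variable {φ : Flow ℝ≥0 Config}

theorem flow_rim (hφ : Generates circulatingField φ) (r : Bool) (i : Fin 3)
    {v w : Icc (-1 : ℝ) 1} {t : ℝ≥0} (hvw : (v : ℝ) + t = w) : φ t (rim r i v) = rim r i w := by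
  refine forall_of_forall_le_of_add one_pos (P := fun t => ∀ v w : Icc (-1 : ℝ) 1,
    (v : ℝ) + t = w → φ t (rim r i v) = rim r i w) (fun t ht v w hvw => ?_)
    (fun s t hs ht v w hvw => ?_) t v w hvw
  · have hhit : (t : ℝ) ≤ hit 1 v := by
      refine not_lt.1 ((gap_pos_iff one_pos v.2.2 t.coe_nonneg).not.1 ?_)
      simp only [gap, travel_one, growth_one, hvw]
      linarith [w.2.2]
    refine Subtype.ext ((hφ.eq_run (chartDomain_rim i v.2) rfl
      (one_lt_log_three.trans_le' ht)).trans ?_)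
    rw [run_of_le hhit, growth_one, travel_one, hvw]
    rfl
  · rw [NNReal.coe_add, ← add_assoc, add_right_comm] at hvw
    have hmid : (v : ℝ) + t ∈ Icc (-1 : ℝ) 1 :=
      ⟨by linarith [v.2.1, t.coe_nonneg], by linarith [w.2.2, s.coe_nonneg]⟩
    rw [φ.map_add, ht v ⟨_, hmid⟩ rfl, hs ⟨_, hmid⟩ w hvw]

theorem flow_node (hφ : Generates circulatingField φ) (a : Bool × Fin 3) :
    φ 2 (node a) = node (nextNode a) :=
  (hφ.flow_rim a.1 a.2 (w := ⟨1, by simp⟩) (by norm_num)).trans (rim_one a.1 a.2)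

theorem flow_node_iterate (hφ : Generates circulatingField φ) (n : ℕ) (a : Bool × Fin 3) :
    φ (n * 2) (node a) = node (nextNode^[n] a) := by
  induction n with
  | zero => rw [Nat.cast_zero, zero_mul, φ.map_zero_apply, Function.iterate_zero_apply]
  | succ n ih =>
    rw [Function.iterate_succ_apply', ← hφ.flow_node, ← ih, ← φ.map_add, Nat.cast_succ,
      add_one_mul, add_comm]

theorem isPeriodicOrbit_discBoundary (hφ : Generates circulatingField φ) :
    IsPeriodicOrbit φ discBoundary := by
  let a : Bool × Fin 3 := (false, 0)
  refine ⟨node a, ⟨(6 : ℕ) * 2, by norm_num, ?_⟩,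
    hφ.exists_flow_ne (circulatingField_ne_zero _), ?_⟩
  · rw [hφ.flow_node_iterate, nextNode_iterate_six]
  · refine Subset.antisymm (fun q hq => ?_)
      (range_subset_iff.2 (hφ.flow_mem_discBoundary (rim_mem_discBoundary _ _ _)))
    obtain ⟨r, i, w, rfl⟩ := exists_eq_rim hq
    obtain ⟨n, hn⟩ := exists_nextNode_iterate_eq a (r, i)
    have hw : 0 ≤ (w : ℝ) + 1 := by linarith [w.2.1]
    refine ⟨((w : ℝ) + 1).toNNReal + n * 2, ?_⟩
    change φ _ (node a) = _
    rw [φ.map_add, hφ.flow_node_iterate, hn]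
    exact hφ.flow_rim r i (by rw [Real.coe_toNNReal _ hw]; ring)

end Generates

/-! ### Attraction -/

theorem exists_lt_inter_preimage_Ici_subset {α : Type*} [TopologicalSpace α] {K U : Set α}
    (hK : IsCompact K) {f : α → ℝ} (hf : Continuous f) {b : ℝ}
    (hU : U ∈ 𝓝ˢ (K ∩ f ⁻¹' Ici b)) : ∃ c < b, K ∩ f ⁻¹' Ici c ⊆ U := by
  rcases (K \ interior U).eq_empty_or_nonempty with hempty | hne
  · exact ⟨b - 1, sub_one_lt b,
      inter_subset_left.trans ((sdiff_eq_empty.1 hempty).trans interior_subset)⟩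
  · obtain ⟨x, hx, hmax⟩ := (hK.diff isOpen_interior).exists_isMaxOn hne hf.continuousOn
    have hxb : f x < b := lt_of_not_ge fun h =>
      hx.2 (subset_interior_iff_mem_nhdsSet.2 hU ⟨hx.1, h⟩)
    obtain ⟨c, hxc, hcb⟩ := exists_between hxb
    refine ⟨c, hcb, fun y hy => by_contra fun hyU => ?_⟩
    exact (hxc.trans_le hy.2).not_ge (hmax ⟨hy.1, fun h => hyU (interior_subset h)⟩)

theorem isCompact_graph : IsCompact graph := by
  have hgraph : graph = ⋃ i, (fun s : ℝ => s • e i) '' Icc 0 1 := by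
    ext x
    simp only [graph, mem_ofPred_eq, mem_iUnion, mem_image, eq_comm]
  rw [hgraph]
  exact isCompact_iUnion fun i => isCompact_Icc.image (by fun_prop)

/-- The closed annulus that remains of the disc when the configurations within distance `c` of the
puncture are removed. -/
def core (c : ℝ) : Set Config := {p | p ∈ disc ∧ c ≤ ‖(p : Pairs)‖}

theorem coe_image_core {c : ℝ} (hc : 0 < c) : (Subtype.val '' core c : Set Pairs) =
    graph ×ˢ graph ∩ ({p | ∀ k, p.1 k * p.2 k = 0} ∩ {p | c ≤ ‖p‖}) := by
  ext p
  constructor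
  · rintro ⟨p, hp, rfl⟩
    exact ⟨⟨p.2.1, p.2.2.1⟩, mem_disc_iff.1 hp.1, hp.2⟩
  · rintro ⟨⟨hx, hy⟩, hdisj, hnorm⟩
    have hne : p.1 ≠ p.2 := fun heq => by
      have hp : p = 0 := Prod.ext (funext fun k => mul_self_eq_zero.1 (heq ▸ hdisj k))
        (funext fun k => mul_self_eq_zero.1 (heq ▸ hdisj k))
      rw [hp, mem_ofPred_eq, norm_zero] at hnorm
      exact hc.not_ge hnorm
    exact ⟨⟨p, hx, hy, hne⟩, ⟨mem_disc_iff.2 hdisj, hnorm⟩, rfl⟩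

theorem isCompact_coe_image_core {c : ℝ} (hc : 0 < c) :
    IsCompact (Subtype.val '' core c : Set Pairs) := by
  rw [coe_image_core hc]
  refine (isCompact_graph.prod isCompact_graph).inter_right (IsClosed.inter ?_ ?_)
  · rw [ofPred_forall]
    exact isClosed_iInter fun k => isClosed_eq (by fun_prop) continuous_const
  · exact isClosed_le continuous_const continuous_norm

theorem exists_core_subset {U : Set Config} (hU : U ∈ 𝓝ˢ discBoundary) :
    ∃ c < 1, core c ⊆ U := by
  have hhalf : IsCompact (core (1 / 2)) :=
    Topology.IsInducing.subtypeVal.isCompact_iff.2 (isCompact_coe_image_core one_half_pos)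
  have hrim : core (1 / 2) ∩ (fun p : Config => ‖(p : Pairs)‖) ⁻¹' Ici 1 ⊆ discBoundary :=
    fun p hp => mem_discBoundary_iff.2
      ⟨hp.1.1, (norm_mem_Ioc_of_mem_Config p.2).2.antisymm hp.2⟩
  obtain ⟨c, hc, hcU⟩ := exists_lt_inter_preimage_Ici_subset hhalf
    (continuous_subtype_val.norm) (nhdsSet_mono hrim hU)
  exact ⟨max (1 / 2) c, max_lt one_half_lt_one hc, fun p hp =>
    hcU ⟨⟨hp.1, (le_max_left _ _).trans hp.2⟩, (le_max_right _ _).trans hp.2⟩⟩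

theorem eventually_le_growth {M c : ℝ} (hM : 0 < M) (hc : c < 1) :
    ∀ᶠ t : ℝ≥0 in atTop, c ≤ growth M t :=
  ((tendsto_growth hM).comp (NNReal.tendsto_coe_atTop.2 tendsto_id)).eventually_const_le hc

theorem exists_notMem_discBoundary : ∃ q : Config, q ∉ discBoundary := by
  have h : ChartDomain 0 0 (1 / 2) 0 :=
    ⟨by norm_num, by norm_num, by norm_num, by norm_num, by decide, by norm_num⟩
  refine ⟨⟨_, chart_mem_Config false h⟩, fun hq => ?_⟩
  have hnorm := (mem_discBoundary_iff.1 hq).2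
  rw [norm_chart false 0 0 h.abs_le] at hnorm
  norm_num at hnorm

theorem exists_mem_discBoundary_index_eq {i j : Fin 3} (hij : i ≠ j) :
    ∃ q ∈ discBoundary, index q.1.1 = some i ∧ index q.1.2 = some j := by
  have hi : index ((1 : ℝ) • e i) = some i := index_smul_e one_pos i
  have hj : index ((1 : ℝ) • e j) = some j := index_smul_e one_pos j
  refine ⟨⟨((1 : ℝ) • e i, (1 : ℝ) • e j), smul_e_mem_graph i zero_le_one le_rfl,
    smul_e_mem_graph j zero_le_one le_rfl, fun h => hij (smul_e_inj one_ne_zero h).1⟩,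
    ⟨?_, Or.inl ((norm_smul_e 1 i).trans abs_one)⟩, hi, hj⟩
  change index _ ≠ index _
  rw [hi, hj]
  exact fun h => hij (Option.some.inj h)

namespace Generates

variable {φ : Flow ℝ≥0 Config}

theorem flow_mem_core (hφ : Generates circulatingField φ) {p : Config} {t : ℝ≥0} {c : ℝ}
    (ht : 1 ≤ t) (hc : c ≤ growth ‖(p : Pairs)‖ t) : φ t p ∈ core c :=
  ⟨hφ.flow_mem_disc_of_one_le p ht, hc.trans_eq (hφ.norm_flow p t).symm⟩

theorem approaches_discBoundary (hφ : Generates circulatingField φ) (p : Config) :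
    Approaches φ p discBoundary := by
  refine hφ.isPeriodicOrbit_discBoundary.approaches_of_tendsto fun U hU => ?_
  obtain ⟨c, hc, hcU⟩ := exists_core_subset hU
  rw [mem_map]
  filter_upwards [eventually_ge_atTop 1,
    eventually_le_growth (norm_mem_Ioc_of_mem_Config p.2).1 hc] with t ht hct
  exact hcU (hφ.flow_mem_core ht hct)

theorem exists_nhdsSet_discBoundary_flow_mem (hφ : Generates circulatingField φ) {V : Set Config}
    (hV : V ∈ 𝓝ˢ discBoundary) : ∃ W ∈ 𝓝ˢ discBoundary, ∀ p ∈ W, ∀ t, φ t p ∈ V := by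
  have hΓ := hφ.isPeriodicOrbit_discBoundary
  obtain ⟨W, hW, hWV⟩ := exists_nhdsSet_forall_le_flow_mem hΓ.isCompact hΓ.mapsTo hV 1
  obtain ⟨c, hc, hcV⟩ := exists_core_subset hV
  have hopen : IsOpen {p : Config | c < ‖(p : Pairs)‖} :=
    isOpen_lt continuous_const continuous_subtype_val.norm
  refine ⟨_, inter_mem hW (hopen.mem_nhdsSet.2 fun p hp =>
    hc.trans_eq (mem_discBoundary_iff.1 hp).2.symm), fun p hp t => ?_⟩
  rcases le_total t 1 with ht | ht
  · exact hWV p hp.1 t ht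
  · have hnorm := norm_mem_Ioc_of_mem_Config p.2
    exact hcV (hφ.flow_mem_core ht (hp.2.le.trans (le_growth hnorm.1.le hnorm.2 t.coe_nonneg)))

theorem isAttractingLimitCycle_discBoundary (hφ : Generates circulatingField φ) :
    IsAttractingLimitCycle φ discBoundary :=
  ⟨hφ.isPeriodicOrbit_discBoundary,
    exists_notMem_discBoundary.imp fun q hq => ⟨hq, hφ.approaches_discBoundary q⟩,
    fun _ hV => hφ.exists_nhdsSet_discBoundary_flow_mem hV,
    univ, univ_mem, fun p _ => hφ.approaches_discBoundary p⟩

theorem isRepelling_diagonal (hφ : Generates circulatingField φ) : IsRepelling φ diagonal := by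
  refine ⟨(Subtype.val '' core (1 / 2))ᶜ,
    (isCompact_coe_image_core one_half_pos).isClosed.isOpen_compl.mem_nhdsSet.2 ?_, ?_⟩
  · rintro _ ⟨-, hq⟩ ⟨p, -, rfl⟩
    exact p.2.2.2 hq.symm
  · intro V hV
    have hzero : (0 : Pairs) ∈ diagonal := ⟨⟨0, 0, by simp, by simp⟩, rfl⟩
    obtain ⟨c, hc, hcV⟩ := Metric.mem_nhds_iff.1 (nhds_le_nhdsSet hzero hV)
    obtain ⟨T, hT⟩ := eventually_atTop.1 (eventually_le_growth hc one_half_lt_one)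
    refine ⟨max 1 T, fun p hp t ht hmem => hmem (mem_image_of_mem _ ?_)⟩
    have hcp : c ≤ ‖(p : Pairs)‖ := not_lt.1 fun h => hp (hcV (mem_ball_zero_iff.2 h))
    exact hφ.flow_mem_core (le_of_max_le_left ht)
      ((hT t (le_of_max_le_right ht)).trans (growth_mono_left hc.le hcp t.coe_nonneg))

end Generates

/-! ### Piecewise smoothness -/

/-- The vertices of the triangle of all `(M, u)` with `0 ≤ u ≤ M ≤ 1`. -/
def triangle : Set (ℝ × ℝ) := {(0, 0), (1, 0), (1, 1)}

theorem finite_triangle : triangle.Finite := by simp [triangle]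

/-- The pairs `(M, u)` of distances from the central vertex such that the configurations with the
leading point at distance `M` on the edge `i` and the other point at distance `u` on the edge `k`
form a cell of the field. Of two neighbouring cells, only one contains their common boundary. -/
def cellParam (i k : Fin 3) : Set (ℝ × ℝ) :=
  {q | q.1 ∈ Ioc 0 1 ∧ q.2 ∈ Icc 0 q.1 ∧ (k ≠ i + 1 → 0 < q.2) ∧ (k ≠ i + 2 → q.2 < q.1)}

theorem convex_cellParam (i k : Fin 3) : Convex ℝ (cellParam i k) := by
  rintro ⟨M, u⟩ ⟨hM, hu, hpos, hlt⟩ ⟨N, w⟩ ⟨hN, hw, hpos', hlt'⟩ a b ha hb hab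
  refine ⟨convex_Ioc (0 : ℝ) 1 hM hN ha hb hab,
    ⟨convex_Ici (0 : ℝ) hu.1 hw.1 ha hb hab, add_le_add (smul_le_smul_of_nonneg_left hu.2 ha)
      (smul_le_smul_of_nonneg_left hw.2 hb)⟩,
    fun hk => convex_Ioi (0 : ℝ) (hpos hk) (hpos' hk) ha hb hab, fun hk => ?_⟩
  have hgap := convex_Ioi (0 : ℝ) (sub_pos.2 (hlt hk)) (sub_pos.2 (hlt' hk)) ha hb hab
  simp only [mem_Ioi, smul_sub] at hgap
  change a • u + b • w < a • M + b • N
  linarith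

theorem cellParam_subset_convexHull (i k : Fin 3) : cellParam i k ⊆ convexHull ℝ triangle := by
  rintro ⟨M, u⟩ ⟨hM, hu, -⟩
  refine mem_convexHull_of_exists_fintype ![1 - M, M - u, u] ![(0, 0), (1, 0), (1, 1)] ?_ ?_ ?_ ?_
  · simpa [Fin.forall_fin_succ] using ⟨hM.2, hu.2, hu.1⟩
  · simp [Fin.sum_univ_three]
  · simp [Fin.forall_fin_succ, triangle]
  · simp [Fin.sum_univ_three]

theorem triangle_subset_closure_cellParam (i k : Fin 3) : triangle ⊆ closure (cellParam i k) := by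
  intro w hw
  have hseg : openSegment ℝ w (1, 1 / 2) ⊆ cellParam i k := by
    rintro _ ⟨a, b, ha, hb, hab, rfl⟩
    rcases hw with rfl | rfl | rfl <;>
    · simp only [cellParam, Prod.smul_mk, Prod.mk_add_mk, smul_eq_mul, mem_ofPred_eq]
      refine ⟨⟨?_, ?_⟩, ⟨?_, ?_⟩, fun _ => ?_, fun _ => ?_⟩ <;> linarith
  exact closure_mono hseg (segment_subset_closure_openSegment (left_mem_segment ℝ _ _))

theorem closure_cellParam (i k : Fin 3) : closure (cellParam i k) = convexHull ℝ triangle :=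
  (closure_minimal (cellParam_subset_convexHull i k)
    (finite_triangle.isClosed_convexHull ℝ)).antisymm
    (convexHull_min (triangle_subset_closure_cellParam i k) (convex_cellParam i k).closure)

/-- The linear parametrization of a cell: the leading point, which is the second one if `r` holds,
is at distance `q.1` on the edge `i`, and the other point at distance `q.2` on the edge `k`. -/
def cellMap (r : Bool) (i k : Fin 3) : ℝ × ℝ →L[ℝ] Pairs :=
  (swapIf r : Pairs →L[ℝ] Pairs) ∘L ((ContinuousLinearMap.toSpanSingleton ℝ (e i)).prodMap
    (ContinuousLinearMap.toSpanSingleton ℝ (e k)))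

theorem cellMap_apply (r : Bool) (i k : Fin 3) (q : ℝ × ℝ) :
    cellMap r i k q = swapIf r (q.1 • e i, q.2 • e k) := rfl

/-- The set of the configurations parametrized by `cellParam`. -/
def cell (r : Bool) (i k : Fin 3) : Set Pairs := cellMap r i k '' cellParam i k

theorem convex_cell (r : Bool) (i k : Fin 3) : Convex ℝ (cell r i k) :=
  (convex_cellParam i k).linear_image (cellMap r i k : ℝ × ℝ →ₗ[ℝ] Pairs)

theorem closure_cell (r : Bool) (i k : Fin 3) :
    closure (cell r i k) = convexHull ℝ (cellMap r i k '' triangle) := by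
  have himage := (cellMap r i k : ℝ × ℝ →ₗ[ℝ] Pairs).image_convexHull triangle
  rw [ContinuousLinearMap.coe_coe, ← closure_cellParam i k] at himage
  rw [← himage, cell]
  refine (image_closure_of_isCompact ?_ (cellMap r i k).continuous.continuousOn).symm
  rw [closure_cellParam]
  exact finite_triangle.isCompact_convexHull ℝ

theorem exists_chart_of_mem_cellParam (r : Bool) {i k : Fin 3} {q : ℝ × ℝ}
    (hq : q ∈ cellParam i k) :
    ∃ j v, ChartDomain i j q.1 v ∧ v < q.1 ∧ cellMap r i k q = chart r i j q.1 v ∧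
      if k = i + 1 then 0 ≤ v else v < 0 ∧ j = k := by
  obtain ⟨⟨hM, hM₁⟩, ⟨hu, huM⟩, hpos, hlt⟩ := hq
  have hne : ∀ a : Fin 3, a ≠ a + 2 ∧ a + 1 ≠ a + 2 := by decide
  split_ifs with hk
  · subst hk
    have huM' := hlt (hne i).2
    exact ⟨i, q.2, ⟨hM, hM₁, by linarith, huM, ne_add_one i, fun _ => by linarith⟩, huM',
      (chart_of_nonneg r i i q.1 hu).symm, hu⟩
  · have hu' := hpos hk
    have hneg : k = i → -q.1 < -q.2 := fun hki =>
      neg_lt_neg (hlt (hki ▸ (hne i).1))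
    refine ⟨k, -q.2, ⟨hM, hM₁, neg_le_neg huM, by linarith, hk, hneg⟩, by linarith, ?_,
      neg_lt_zero.2 hu', rfl⟩
    rw [chart_of_nonpos r i k q.1 (neg_nonpos.2 hu), neg_neg, cellMap_apply]

theorem exists_mem_cell {p : Pairs} (hp : p ∈ Config) : ∃ r i k, p ∈ cell r i k := by
  obtain ⟨r, i, j, M, v, h, hv, rfl⟩ := exists_chart hp
  rcases le_or_gt 0 v with hv₀ | hv₀
  · exact ⟨r, i, i + 1, (M, v), ⟨⟨h.pos, h.le_one⟩, ⟨hv₀, h.le⟩, fun hi => absurd rfl hi,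
      fun _ => hv⟩, (chart_of_nonneg r i j M hv₀).symm⟩
  · have hlt : j ≠ i + 2 → -v < M := fun hj =>
      neg_lt.1 (h.neg_lt (not_imp_comm.1 (eq_add_two_of_ne · h.ne) hj))
    exact ⟨r, i, j, (M, -v), ⟨⟨h.pos, h.le_one⟩, ⟨neg_nonneg.2 hv₀.le, neg_le.1 h.neg_le⟩,
      fun _ => neg_pos.2 hv₀, hlt⟩, (chart_of_nonpos r i j M hv₀.le).symm⟩

theorem iUnion_cell : ⋃ c : Bool × Fin 3 × Fin 3, cell c.1 c.2.1 c.2.2 = Config := by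
  refine Subset.antisymm (iUnion_subset fun c => ?_) fun p hp => ?_
  · rintro _ ⟨q, hq, rfl⟩
    obtain ⟨j, v, h, -, hpc, -⟩ := exists_chart_of_mem_cellParam c.1 hq
    exact hpc ▸ chart_mem_Config c.1 h
  · obtain ⟨r, i, k, hpc⟩ := exists_mem_cell hp
    exact mem_iUnion.2 ⟨(r, i, k), hpc⟩

/-- A smooth extension of the restriction of the circulating field to a cell. -/
def cellField (r : Bool) (i k : Fin 3) (p : Pairs) : Pairs :=
  let M := (swapIf r p).1 i
  swapIf r ((M * (1 - M)) • e i, (if k = i + 1 then M else -M) • e k)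

theorem contDiff_cellField (r : Bool) (i k : Fin 3) : ContDiff ℝ ∞ (cellField r i k) := by
  unfold cellField
  split_ifs <;> fun_prop

theorem circulatingField_eq_cellField {r : Bool} {i k : Fin 3} {p : Config}
    (hp : (p : Pairs) ∈ cell r i k) : circulatingField p = cellField r i k p := by
  obtain ⟨q, hq, hqp⟩ := hp
  obtain ⟨j, v, h, hv, hpc, hjv⟩ := exists_chart_of_mem_cellParam r hq
  have hlead : (swapIf r p).1 i = q.1 := by
    rw [← hqp, cellMap_apply, swapIf_swapIf]
    exact (smul_e_apply q.1 i i).trans (if_pos rfl)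
  rw [circulatingField_chart h hv (hqp.symm.trans hpc), cellField, hlead]
  split_ifs at hjv with hk
  · rw [if_neg hjv.not_gt, if_pos hk, hk]
  · rw [if_pos hjv.1, if_neg hk, hjv.2]

theorem isPiecewiseSmoothVectorField_circulatingField :
    IsPiecewiseSmoothVectorField circulatingField := by
  obtain ⟨φ, hφ⟩ := exists_generates_circulatingField
  let c := (Fintype.equivFin (Bool × Fin 3 × Fin 3)).symm
  refine ⟨hφ.mem_posTangentConeAt, _, fun n => cell (c n).1 (c n).2.1 (c n).2.2,
    fun n => cellField (c n).1 (c n).2.1 (c n).2.2, ?_, fun n => ⟨convex_cell _ _ _,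
      ⟨_, finite_triangle.image _, closure_cell _ _ _⟩, contDiff_cellField _ _ _,
      fun p hp => circulatingField_eq_cellField hp⟩⟩
  rw [← iUnion_cell]
  exact c.surjective.iUnion_comp fun c => cell c.1 c.2.1 c.2.2

end YGraph

end

theorem mainTheorem2 :
    ∃ X : YGraph.Config → YGraph.Pairs,
      X = YGraph.circulatingField ∧
      YGraph.IsPiecewiseSmoothVectorField X ∧
      (∀ p, X p ≠ 0) ∧
      ∃ φ : Flow ℝ≥0 YGraph.Config,
        YGraph.Generates X φ ∧
        YGraph.IsRepelling φ YGraph.diagonal ∧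
        ∃ Γ : Set YGraph.Config,
          Γ = YGraph.discBoundary ∧
          YGraph.IsAttractingLimitCycle φ Γ ∧
          (∀ Γ' : Set YGraph.Config, YGraph.IsPeriodicOrbit φ Γ' → Γ' = Γ) ∧
          (∀ p : YGraph.Config, YGraph.Approaches φ p Γ) ∧
          ∀ p ∈ Γ, ∀ i j : Fin 3, i ≠ j →
            ∃ t : ℝ≥0, YGraph.index (φ t p).1.1 = some i ∧ YGraph.index (φ t p).1.2 = some j := by
  obtain ⟨φ, hφ⟩ := YGraph.exists_generates_circulatingField
  have hΓ := hφ.isPeriodicOrbit_discBoundary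
  refine ⟨YGraph.circulatingField, rfl, YGraph.isPiecewiseSmoothVectorField_circulatingField,
    YGraph.circulatingField_ne_zero, φ, hφ, hφ.isRepelling_diagonal, YGraph.discBoundary, rfl,
    hφ.isAttractingLimitCycle_discBoundary,
    fun Γ' hΓ' => hΓ.eq_of_approaches hΓ' fun p _ => hφ.approaches_discBoundary p,
    hφ.approaches_discBoundary, fun p hp i j hij => ?_⟩
  obtain ⟨q, hq, hi, hj⟩ := YGraph.exists_mem_discBoundary_index_eq hij
  rw [← hΓ.range_eq hp] at hq
  obtain ⟨t, rfl⟩ := hq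
  exact ⟨t, hi, hj⟩
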